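/- Let $d\in\{2,3\}$ and write $x_d$ for the vertical coordinate of $x\in\mathbb R^d$ and $e_d$ for the vertical unit vector. Call a bounded open set $U\subset\mathbb R^d$ piecewise $C^1$ if $\partial U$ has finite $(d-1)$-dimensional surface (Hausdorff) measure $\sigma$ and, outside a $\sigma$-null subset of $\partial U$, $\partial U$ is locally a $C^1$ hypersurface with $U$ on one side. Let $\Omega^n$ be a piecewise $C^1$ bounded open set divided into two disjoint piecewise $C^1$ open subsets $\Omega^n_1,\Omega^n_2\subset\Omega^n$ with $\overline{\Omega^n}=\overline{\Omega^n_1}\cup\overline{\Omega^n_2}$. Let $\Sigma^n=\partial\Omega^n_1\cap\partial\Omega^n_2$ be the interface, $\mathbf n_{\Sigma^n}$ the unit normal outward to $\Omega_1^n$, and $n^d_{\Sigma^n}$ its vertical component. Let $\rho_1,\rho_2,g\in\mathbb R$, $\delta\rho=\rho_2-\rho_1$ and $\delta t>0$. Let $\mathbf w^n:\overline{\Omega^n}\to\mathbb R^d$ be a mesh velocity with the following properties: $\mathbf w^n$ is, on each $\overline{\Omega^n_i}$, the restriction of a $C^1$ map on $\mathbb R^d$; it is tangent to the wall, i.e. $\mathbf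 w^n\cdot\mathbf n_{\partial\Omega^n}=0$ at the regular points of $\partial\Omega^n$; and the map $\mathcal A(y)=y+\delta t\,\mathbf w^n(y)$ is injective on $\overline{\Omega^n}$ with positive Jacobian determinant on each $\overline{\Omega_i^n}$. Put $\Omega^{n+1}=\mathcal A(\Omega^n)$, $\Omega^{n+1}_i=\mathcal A(\Omega^n_i)$, $\Sigma^{n+1}=\partial\Omega^{n+1}_1\cap\partial\Omega^{n+1}_2$, and let $\mathbf n_{\Sigma^{n+1}}$ be the unit normal outward to $\Omega_1^{n+1}$. For $k\in\{n,n+1\}$ let $\rho=\rho_i$ on $\Omega^k_i$ ($i=1,2$) and let $W^k=\int_{\Omega^k}\rho\,g\,x_d\,dx$ be the potential energy. Assume that the mesh velocity is vertical: $\mathbf w^n=w^n e_d$ (for $d=3$, $\mathbf w^n=(0,0,w^n)$). Then all the following integrals converge, and $$\int_{\Sigma^n} g x_d\,\delta\rho\,\mathbf w^n\cdot\mathbf n_{\Sigma^n}\,d\sigma=\int_{\Sigma^n} g x_d\,\delta\rho\,w^n n^d_{\Sigma^n}\,d\sigma=-\frac{W^{n+1}-W^n}{\delta t}-\frac{\delta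 t}{2}\int_{\Sigma^n}\delta\rho\,g\,(w^n)^2 n^d_{\Sigma^n}\,d\sigma,$$ $$\int_{\Sigma^{n+1}} g x_d\,\delta\rho\,(\mathbf w^n\circ\mathcal A^{-1})\cdot\mathbf n_{\Sigma^{n+1}}\,d\sigma=\int_{\Sigma^{n+1}} g x_d\,\delta\rho\,(w^n\circ\mathcal A^{-1})\, n^d_{\Sigma^{n+1}}\,d\sigma=-\frac{W^{n+1}-W^n}{\delta t}+\frac{\delta t}{2}\int_{\Sigma^n}\delta\rho\,g\,(w^n)^2 n^d_{\Sigma^n}\,d\sigma.$$ -/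

import Mathlib

open MeasureTheory Topology Set

noncomputable section

namespace ALE

/-- The physical space `ℝ^d`, with `d = m + 1`; the vertical coordinate is the last one. -/
abbrev Space (m : ℕ) : Type := EuclideanSpace ℝ (Fin (m + 1))

/-- `ν` is the outward unit normal to `U` at the boundary point `p`: near `p`, the set `U` is the
sublevel set `{φ < 0}` of a `C¹` function `φ` with `φ p = 0` and `∇φ(p) ≠ 0`, and
`ν = ∇φ(p) / |∇φ(p)|`. -/
def IsOutwardUnitNormal {m : ℕ} (U : Set (Space m)) (p ν : Space m) : Prop :=
  ∃ φ : Space m → ℝ, ContDiffAt ℝ 1 φ p ∧ φ p = 0 ∧ gradient φ p ≠ 0 ∧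
    (∀ᶠ x in 𝓝 p, x ∈ U ↔ φ x < 0) ∧ ν = ‖gradient φ p‖⁻¹ • gradient φ p

/-- The points near which the boundary of `U` is a `C¹` hypersurface with `U` on one side. -/
def regularBoundary {m : ℕ} (U : Set (Space m)) : Set (Space m) :=
  {p | ∃ ν, IsOutwardUnitNormal U p ν}

open Classical in
/-- The outward unit normal field to `U`, defined on the regular part of the boundary
(and zero elsewhere). -/
def outwardNormal {m : ℕ} (U : Set (Space m)) (p : Space m) : Space m :=
  if h : ∃ ν, IsOutwardUnitNormal U p ν then h.choose else 0

theorem inner_gradient_nonpos {m : ℕ} {U : Set (Space m)} {p v : Space m} {φ ψ : Space m → ℝ}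
    (hφ : ContDiffAt ℝ 1 φ p) (hφ0 : φ p = 0) (hφU : ∀ᶠ x in 𝓝 p, x ∈ U ↔ φ x < 0)
    (hψ : ContDiffAt ℝ 1 ψ p) (hψ0 : ψ p = 0) (hψU : ∀ᶠ x in 𝓝 p, x ∈ U ↔ ψ x < 0)
    (hv : inner ℝ (gradient φ p) v < 0) : inner ℝ (gradient ψ p) v ≤ 0 := by
  have key : ∀ χ : Space m → ℝ, ContDiffAt ℝ 1 χ p → χ p = 0 →
      Filter.Tendsto (fun t : ℝ => t⁻¹ * χ (p + t • v)) (𝓝[>] 0)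
        (𝓝 (inner ℝ (gradient χ p) v)) := by
    intro χ hχ h0
    have h1 : HasFDerivAt χ (fderiv ℝ χ p) p := (hχ.differentiableAt (by norm_num)).hasFDerivAt
    have h2 : HasDerivAt (fun t : ℝ => p + t • v) v 0 := by
      simpa using ((hasDerivAt_id (0 : ℝ)).smul_const v).const_add p
    have h3 : HasDerivAt (fun t : ℝ => χ (p + t • v)) (fderiv ℝ χ p v) 0 := by
      refine HasFDerivAt.comp_hasDerivAt (f := fun t : ℝ => p + t • v) 0 ?_ h2
      simpa using h1
    have h4 := (hasDerivAt_iff_tendsto_slope.1 h3).mono_left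
      (nhdsWithin_mono 0 (fun x (hx : x ∈ Ioi (0 : ℝ)) => (ne_of_gt hx : x ≠ 0)))
    have h5 : inner ℝ (gradient χ p) v = fderiv ℝ χ p v := by
      simp [gradient]
    rw [h5]
    refine h4.congr fun t => ?_
    simp [slope_def_field, h0, div_eq_inv_mul]
  have hline : Filter.Tendsto (fun t : ℝ => p + t • v) (𝓝[>] 0) (𝓝 p) := by
    have : Continuous (fun t : ℝ => p + t • v) := by fun_prop
    simpa using (this.tendsto 0).mono_left nhdsWithin_le_nhds
  refine le_of_tendsto (key ψ hψ hψ0) ?_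
  filter_upwards [(key φ hφ hφ0).eventually_lt_const hv, hline.eventually hφU,
    hline.eventually hψU, self_mem_nhdsWithin] with t h1 h2 h3 ht
  have ht' : 0 < t⁻¹ := inv_pos.2 ht
  have h4 : φ (p + t • v) < 0 := by
    by_contra hcon
    push Not at hcon
    exact absurd h1 (not_lt.2 (mul_nonneg ht'.le hcon))
  exact mul_nonpos_of_nonneg_of_nonpos ht'.le (h3.1 (h2.2 h4)).le

/-- The outward unit normal is determined by the set and the point. -/
theorem IsOutwardUnitNormal.unique {m : ℕ} {U : Set (Space m)} {p ν ν' : Space m}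
    (h : IsOutwardUnitNormal U p ν) (h' : IsOutwardUnitNormal U p ν') : ν = ν' := by
  obtain ⟨φ, hφ, hφ0, hφg, hφU, rfl⟩ := h
  obtain ⟨ψ, hψ, hψ0, hψg, hψU, rfl⟩ := h'
  have key := fun v => inner_gradient_nonpos (v := v) hφ hφ0 hφU hψ hψ0 hψU
  set a := gradient φ p with ha
  set b := gradient ψ p with hb
  have hna : 0 < ‖a‖ := norm_pos_iff.2 hφg
  have hnb : 0 < ‖b‖ := norm_pos_iff.2 hψg
  have ua : ‖‖a‖⁻¹ • a‖ = 1 := by simp [norm_smul, hna.ne']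
  have ub : ‖‖b‖⁻¹ • b‖ = 1 := by simp [norm_smul, hnb.ne']
  by_contra hne
  have hlt : inner ℝ (‖a‖⁻¹ • a) (‖b‖⁻¹ • b) < 1 :=
    (inner_lt_one_iff_real_of_norm_eq_one ua ub).2 hne
  have ea : a = ‖a‖ • (‖a‖⁻¹ • a) := by rw [smul_smul, mul_inv_cancel₀ hna.ne', one_smul]
  have eb : b = ‖b‖ • (‖b‖⁻¹ • b) := by rw [smul_smul, mul_inv_cancel₀ hnb.ne', one_smul]
  have h1 : inner ℝ a (‖b‖⁻¹ • b - ‖a‖⁻¹ • a) < 0 := by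
    rw [show inner ℝ a (‖b‖⁻¹ • b - ‖a‖⁻¹ • a)
      = ‖a‖ * inner ℝ (‖a‖⁻¹ • a) (‖b‖⁻¹ • b - ‖a‖⁻¹ • a) by
        rw [← real_inner_smul_left, ← ea], inner_sub_right, real_inner_self_eq_norm_sq, ua]
    nlinarith
  have h2 := key _ h1
  rw [show inner ℝ b (‖b‖⁻¹ • b - ‖a‖⁻¹ • a)
      = ‖b‖ * inner ℝ (‖b‖⁻¹ • b) (‖b‖⁻¹ • b - ‖a‖⁻¹ • a) by
        rw [← real_inner_smul_left, ← eb], inner_sub_right, real_inner_self_eq_norm_sq, ub,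
      real_inner_comm] at h2
  nlinarith

theorem IsOutwardUnitNormal.outwardNormal_eq {m : ℕ} {U : Set (Space m)} {p ν : Space m}
    (h : IsOutwardUnitNormal U p ν) : outwardNormal U p = ν := by
  have hex : ∃ ν, IsOutwardUnitNormal U p ν := ⟨ν, h⟩
  unfold outwardNormal
  rw [dif_pos hex]
  exact hex.choose_spec.unique h

/-- Bounded open sets with piecewise `C¹` boundary: the boundary has finite surface measure and is,
outside a set of zero surface measure (edges, corners, the contact line), a `C¹` hypersurface with
the set on one side. The surface measure is the `(d-1)`-dimensional Hausdorff measure, normalized so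
as to be the Lebesgue measure on hyperplanes. -/
structure IsPiecewiseC1Domain {m : ℕ} (U : Set (Space m)) : Prop where
  isOpen : IsOpen U
  isBounded : Bornology.IsBounded U
  measure_frontier_lt_top : (μHE[m] : Measure (Space m)) (frontier U) < ⊤
  measure_singular : (μHE[m] : Measure (Space m)) (frontier U \ regularBoundary U) = 0

/-- The domain `Ω` is divided into the two subdomains `Ω₁` and `Ω₂`. -/
structure IsTwoFluidDomain {m : ℕ} (Ω Ω₁ Ω₂ : Set (Space m)) : Prop where
  domain : IsPiecewiseC1Domain Ω
  domain₁ : IsPiecewiseC1Domain Ω₁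
  domain₂ : IsPiecewiseC1Domain Ω₂
  subset₁ : Ω₁ ⊆ Ω
  subset₂ : Ω₂ ⊆ Ω
  disjoint : Disjoint Ω₁ Ω₂
  closure_eq : closure Ω = closure Ω₁ ∪ closure Ω₂

/-- The interface between the two fluids. -/
def interface {m : ℕ} (Ω₁ Ω₂ : Set (Space m)) : Set (Space m) :=
  frontier Ω₁ ∩ frontier Ω₂

/-- The density, equal to `ρ₁` in the first fluid and to `ρ₂` in the second one. -/
def density {m : ℕ} (ρ₁ ρ₂ : ℝ) (Ω₁ Ω₂ : Set (Space m)) (x : Space m) : ℝ :=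
  Ω₁.indicator (fun _ => ρ₁) x + Ω₂.indicator (fun _ => ρ₂) x

/-- The potential energy `∫_Ω ρ g x_d dx`. -/
def potentialEnergy {m : ℕ} (g ρ₁ ρ₂ : ℝ) (Ω Ω₁ Ω₂ : Set (Space m)) : ℝ :=
  ∫ x in Ω, density ρ₁ ρ₂ Ω₁ Ω₂ x * g * x (Fin.last m)

/-- The map `y ↦ y + δt v(y)` which moves the mesh during one time step. -/
def meshMap {m : ℕ} (δt : ℝ) (v : Space m → Space m) (y : Space m) : Space m :=
  y + δt • v y

/-- `f ∘ A⁻¹`, where `A` is the mesh map on `closure Ω`. -/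
def transported {m : ℕ} {F : Type*} (δt : ℝ) (v : Space m → Space m) (Ω : Set (Space m))
    (f : Space m → F) (x : Space m) : F :=
  f (Function.invFunOn (meshMap δt v) (closure Ω) x)

/-- `v` is `C¹` up to the boundary on the subdomain `U`, and its mesh map has positive Jacobian
determinant there. -/
def IsSmoothMotionOn {m : ℕ} (U : Set (Space m)) (δt : ℝ) (v : Space m → Space m) : Prop :=
  ∃ W : Space m → Space m, ContDiff ℝ 1 W ∧ EqOn v W (closure U) ∧
    ∀ y ∈ closure U, 0 < (fderiv ℝ (meshMap δt W) y).det

/-- `v` is an admissible mesh velocity for the time step `δt`: it is `C¹` up to the boundary on each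
of the two subdomains (hence continuous across the interface, being single-valued there), it is
tangent to the wall, and its mesh map is injective with positive Jacobian determinant. -/
structure IsMeshVelocity {m : ℕ} (Ω Ω₁ Ω₂ : Set (Space m)) (δt : ℝ)
    (v : Space m → Space m) : Prop where
  smooth₁ : IsSmoothMotionOn Ω₁ δt v
  smooth₂ : IsSmoothMotionOn Ω₂ δt v
  injOn : InjOn (meshMap δt v) (closure Ω)
  tangent : ∀ p ∈ regularBoundary Ω, inner ℝ (v p) (outwardNormal Ω p) = 0

end ALE

end

open ALE

/-!
Only the vertical component `n_d` of the normals enters the identities, and the motion preserves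
vertical lines. Everything therefore reduces to integration along vertical lines.

The link is the area formula for the horizontal projection of the boundary. Near a regular boundary
point with normal `ν`, a `C¹` hypersurface is almost isometric to the hyperplane `ν^⊥`, and the
horizontal projection restricted to `ν^⊥` has Jacobian `|ν_d|` (`exists_tangent_coordinates`).
Comparing measures at small scales and summing over a countable cover gives
`∫_Γ h |n_d| dσ = ∫ ∑_{t : (y, t) ∈ Γ} h (y, t) dy` (`lintegral_mul_normalHeight`) and its signed form
`setIntegral_mul_normalHeight`. The singular boundary points and the points with `n_d = 0` project
onto null sets, so almost every vertical line crosses the boundary transversally, at finitely many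
regular points.

Two consequences carry the argument. The first is the divergence theorem for a vertical field
(`setIntegral_fderiv_vertical`): apply the one-dimensional fundamental theorem on each line. The
second is that a vertical motion preserves the flux of a vertical field
(`IsRegularMotion.setIntegral_image_mul_normalHeight`): the signed sums before and after the motion
agree line by line, since the motion keeps the side on which the domain lies.

On a subdomain the Jacobian determinant of the motion is `1 + δt ∂_d w`, so the first moment of
height changes by the integral of the vertical derivative of `((x_d + δt w)² - x_d²) / 2`, that is,
by the flux of `δt x_d w + δt² w² / 2` through the boundary. On the wall `w n_d = 0` by tangency, and on
the interface the two normals are opposite almost everywhere, so that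
`W^{n+1} - W^n = -δρ g ∫_Σ (δt x_d w + δt² w² / 2) n_d dσ`. This is the first identity. In the second one
the integral over the new interface is pulled back to the old one, where `x_d` becomes
`x_d + δt w`.
-/

/-! ### Horizontal projection and tangent hyperplanes -/

theorem LipschitzOnWith.euclideanHausdorffMeasure_image_le {X Y : Type*} [EMetricSpace X]
    [MeasurableSpace X] [BorelSpace X] [EMetricSpace Y] [MeasurableSpace Y] [BorelSpace Y]
    {f : X → Y} {s : Set X} {K : NNReal} (hf : LipschitzOnWith K f s) (d : ℕ) :
    (μHE[d] : Measure Y) (f '' s) ≤ (K : ENNReal) ^ d * (μHE[d] : Measure X) s := by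
  have h := hf.hausdorffMeasure_image_le (d := d) (Nat.cast_nonneg d)
  rw [ENNReal.rpow_natCast] at h
  simp only [Measure.euclideanHausdorffMeasure_def, Measure.smul_apply, ENNReal.smul_def,
    smul_eq_mul]
  rw [mul_left_comm]
  gcongr

namespace ALE

/-- The orthogonal projection of `ℝ^(m+1)` onto the horizontal hyperplane `ℝ^m`. -/
noncomputable def horiz (m : ℕ) : Space m →L[ℝ] EuclideanSpace ℝ (Fin m) :=
  LinearMap.toContinuousLinearMap
    { toFun := fun x => WithLp.toLp 2 fun i => x i.castSucc
      map_add' := fun _ _ => rfl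
      map_smul' := fun _ _ => rfl }

@[simp] theorem horiz_apply {m : ℕ} (x : Space m) (i : Fin m) : horiz m x i = x i.castSucc := rfl

theorem norm_sq_eq_horiz {m : ℕ} (x : Space m) :
    ‖x‖ ^ 2 = ‖horiz m x‖ ^ 2 + x (Fin.last m) ^ 2 := by
  simp [EuclideanSpace.norm_sq_eq, Fin.sum_univ_castSucc]

theorem norm_horiz_le {m : ℕ} (x : Space m) : ‖horiz m x‖ ≤ ‖x‖ := by
  refine (sq_le_sq₀ (norm_nonneg _) (norm_nonneg _)).1 ?_
  rw [norm_sq_eq_horiz x]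
  nlinarith [sq_nonneg (x (Fin.last m))]

/-- Coordinates adapted to the hyperplane `ν^⊥`: an isometric parametrization `J`, the orthogonal
projection `P` read in these coordinates, and the Jacobian `|ν_d|` of the horizontal projection
restricted to `ν^⊥`. The Jacobian is a minor of an orthogonal matrix, hence up to sign an entry of
its inverse. -/
theorem exists_tangent_coordinates {m : ℕ} {ν : Space m} (hν : ‖ν‖ = 1) :
    ∃ (J : EuclideanSpace ℝ (Fin m) →L[ℝ] Space m) (P : Space m →L[ℝ] EuclideanSpace ℝ (Fin m)),
      (∀ x, x = J (P x) + inner ℝ ν x • ν) ∧ (∀ u, ‖J u‖ = ‖u‖) ∧ (∀ x, ‖P x‖ ≤ ‖x‖) ∧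
      |((horiz m).comp J).det| = |ν (Fin.last m)| := by
  obtain ⟨b, hb⟩ := Orthonormal.exists_orthonormalBasis_extension_of_card_eq
    (𝕜 := ℝ) (E := Space m) (ι := Fin (m + 1)) (by simp) (v := fun _ => ν) (s := {Fin.last m})
    (by
      constructor
      · intro i; simpa [Set.domRestrict] using hν
      · intro i j hij
        exact absurd (Subsingleton.elim i j) hij)
  have hbl : b (Fin.last m) = ν := hb _ rfl
  let P : Space m →L[ℝ] EuclideanSpace ℝ (Fin m) := LinearMap.toContinuousLinearMap
    { toFun := fun x => WithLp.toLp 2 fun i => inner ℝ (b i.castSucc) x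
      map_add' := fun x y => by ext i; simp [inner_add_right]
      map_smul' := fun c x => by ext i; simp [inner_smul_right] }
  let J : EuclideanSpace ℝ (Fin m) →L[ℝ] Space m := LinearMap.toContinuousLinearMap
    { toFun := fun u => ∑ i, u i • b i.castSucc
      map_add' := fun x y => by simp [add_smul, Finset.sum_add_distrib]
      map_smul' := fun c x => by simp [mul_smul, Finset.smul_sum] }
  have hP : ∀ x i, P x i = inner ℝ (b i.castSucc) x := fun _ _ => rfl
  have hJ : ∀ u, J u = ∑ i, u i • b i.castSucc := fun _ => rfl
  refine ⟨J, P, fun x => ?_, fun u => ?_, fun x => ?_, ?_⟩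
  · conv_lhs => rw [← b.sum_repr' x, Fin.sum_univ_castSucc, hbl]
    simp [hJ, hP]
  · have ho : Orthonormal ℝ fun i : Fin m => b i.castSucc :=
      b.orthonormal.comp _ (Fin.castSucc_injective m)
    refine (sq_eq_sq₀ (norm_nonneg _) (norm_nonneg _)).1 ?_
    rw [← real_inner_self_eq_norm_sq, hJ, ho.inner_sum, EuclideanSpace.norm_sq_eq]
    simp [sq]
  · refine (sq_le_sq₀ (norm_nonneg _) (norm_nonneg _)).1 ?_
    rw [EuclideanSpace.norm_sq_eq, ← b.sum_sq_norm_inner_right x, Fin.sum_univ_castSucc]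
    simp only [hP]
    exact le_add_of_nonneg_right (sq_nonneg _)
  · let M : Matrix (Fin (m + 1)) (Fin (m + 1)) ℝ := Matrix.of fun j i => b i j
    have hM : M.transpose * M = 1 := by
      ext i j
      have := (orthonormal_iff_ite.1 b.orthonormal) i j
      simpa [Matrix.mul_apply, M, Matrix.one_apply, PiLp.inner_apply, mul_comm] using this
    have hM' : M * M.transpose = 1 := mul_eq_one_comm.1 hM
    have hdet : |M.det| = 1 := by
      have h := congrArg Matrix.det hM
      rw [Matrix.det_mul, Matrix.det_transpose, Matrix.det_one] at h
      have h2 : |M.det| * |M.det| = 1 := by rw [← abs_mul, h, abs_one]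
      nlinarith [abs_nonneg M.det]
    have hadj : M.adjugate = M.det • M.transpose := by
      have h := congrArg (· * M.transpose) (Matrix.adjugate_mul M)
      simpa [Matrix.mul_assoc, hM'] using h
    have h1 := congrFun (congrFun hadj (Fin.last m)) (Fin.last m)
    rw [Matrix.adjugate_fin_succ_eq_det_submatrix] at h1
    have h2 : ((horiz m).comp J).det = (M.submatrix Fin.castSucc Fin.castSucc).det := by
      rw [ContinuousLinearMap.det,
        ← LinearMap.det_toMatrix (EuclideanSpace.basisFun (Fin m) ℝ).toBasis]
      congr 1
      ext j i
      simp [LinearMap.toMatrix_apply, hJ, M]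
    rw [h2]
    have h3 := congrArg abs h1
    simp only [Fin.succAbove_last] at h3
    rw [abs_mul, abs_pow, abs_neg, abs_one, one_pow, one_mul] at h3
    rw [h3, Matrix.smul_apply, smul_eq_mul, abs_mul, hdet, one_mul, Matrix.transpose_apply]
    simp [M, hbl]

/-- Sets that are flat at scale `c` in the direction `ν`: the tangent coordinates are bi-Lipschitz
on them, and the horizontal projection read in these coordinates is `c`-close to a linear map. -/
theorem exists_approximatesLinearOn_of_flat {m : ℕ} {ν : Space m} (hν : ‖ν‖ = 1) :
    ∃ T : EuclideanSpace ℝ (Fin m) →L[ℝ] EuclideanSpace ℝ (Fin m),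
      |T.det| = |ν (Fin.last m)| ∧ ∀ c : NNReal, c < 1 → ∀ B : Set (Space m),
        (∀ q ∈ B, ∀ q' ∈ B, |inner ℝ ν (q - q')| ≤ c * ‖q - q'‖) →
        ∃ (D : Set (EuclideanSpace ℝ (Fin m)))
          (f : EuclideanSpace ℝ (Fin m) → EuclideanSpace ℝ (Fin m)),
          ApproximatesLinearOn f T D (c * (1 - c)⁻¹) ∧ f '' D = horiz m '' B ∧
          volume D ≤ (μHE[m] : Measure (Space m)) B ∧
          (μHE[m] : Measure (Space m)) B ≤ (((1 - c)⁻¹ : NNReal) : ENNReal) ^ m * volume D := by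
  obtain ⟨J, P, hx, hJ, hP, hdet⟩ := exists_tangent_coordinates hν
  refine ⟨(horiz m).comp J, hdet, fun c hc B hB => ?_⟩
  have hc' : 0 < 1 - (c : ℝ) := by
    have : (c : ℝ) < 1 := by exact_mod_cast hc
    linarith
  have hcc : (((1 - c)⁻¹ : NNReal) : ℝ) = (1 - (c : ℝ))⁻¹ := by
    rw [NNReal.coe_inv, NNReal.coe_sub hc.le, NNReal.coe_one]
  have hanti : ∀ q ∈ B, ∀ q' ∈ B, ‖q - q'‖ ≤ (1 - (c : ℝ))⁻¹ * ‖P q - P q'‖ := by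
    intro q hq q' hq'
    have h1 : ‖q - q'‖ ≤ ‖P (q - q')‖ + |inner ℝ ν (q - q')| := by
      conv_lhs => rw [hx (q - q')]
      refine (norm_add_le _ _).trans ?_
      rw [hJ, norm_smul, hν, mul_one, Real.norm_eq_abs]
    have h2 := hB q hq q' hq'
    rw [map_sub] at h1
    rw [inv_mul_eq_div, le_div_iff₀ hc']
    linarith
  have hinj : InjOn P B := by
    intro q hq q' hq' h
    have := hanti q hq q' hq'
    rw [h, sub_self, norm_zero, mul_zero] at this
    exact sub_eq_zero.1 (norm_le_zero_iff.1 this)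
  let ψ := Function.invFunOn P B
  have hψ : ∀ q ∈ B, ψ (P q) = q := fun q hq => hinj.leftInvOn_invFunOn hq
  refine ⟨P '' B, fun u => horiz m (ψ u), ?_, ?_, ?_, ?_⟩
  · rintro _ ⟨q, hq, rfl⟩ _ ⟨q', hq', rfl⟩
    simp only [hψ q hq, hψ q' hq']
    have h1 : horiz m q - horiz m q' - ((horiz m).comp J) (P q - P q')
        = inner ℝ ν (q - q') • horiz m ν := by
      have h := congrArg (horiz m) (hx (q - q'))
      rw [map_add, map_smul, map_sub, map_sub] at h
      rw [h]
      simp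
    rw [h1, norm_smul, Real.norm_eq_abs, NNReal.coe_mul, hcc, mul_assoc]
    have h2 : ‖horiz m ν‖ ≤ 1 := (norm_horiz_le ν).trans hν.le
    calc |inner ℝ ν (q - q')| * ‖horiz m ν‖ ≤ |inner ℝ ν (q - q')| * 1 := by gcongr
      _ ≤ c * ‖q - q'‖ := by rw [mul_one]; exact hB q hq q' hq'
      _ ≤ c * ((1 - (c : ℝ))⁻¹ * ‖P q - P q'‖) := by gcongr; exact hanti q hq q' hq'
  · rw [image_image]
    exact image_congr fun q hq => by simp only [hψ q hq]
  · have hl : LipschitzOnWith 1 P B := LipschitzOnWith.of_dist_le_mul fun q _ q' _ => by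
      rw [dist_eq_norm, dist_eq_norm, ← map_sub, NNReal.coe_one, one_mul]
      exact hP _
    have := hl.euclideanHausdorffMeasure_image_le m
    rwa [EuclideanSpace.euclideanHausdorffMeasure_eq_volume, ENNReal.coe_one, one_pow, one_mul]
      at this
  · have hl : LipschitzOnWith (1 - c)⁻¹ ψ (P '' B) := by
      refine LipschitzOnWith.of_dist_le_mul ?_
      rintro _ ⟨q, hq, rfl⟩ _ ⟨q', hq', rfl⟩
      rw [hψ q hq, hψ q' hq', dist_eq_norm, dist_eq_norm, hcc]
      exact hanti q hq q' hq'
    have := hl.euclideanHausdorffMeasure_image_le m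
    rw [EuclideanSpace.euclideanHausdorffMeasure_eq_volume, image_image] at this
    rwa [show (fun x => ψ (P x)) '' B = B by
      rw [image_congr fun q hq => hψ q hq, image_id']] at this

theorem tendsto_mul_inv_one_sub_nhdsGT :
    Filter.Tendsto (fun c : NNReal => c * (1 - c)⁻¹) (𝓝[>] 0) (𝓝[>] 0) := by
  refine tendsto_nhdsWithin_iff.2 ⟨?_, ?_⟩
  · have h : ContinuousAt (fun c : NNReal => c * (1 - c)⁻¹) 0 := by
      refine continuousAt_id.mul (ContinuousAt.inv₀ ?_ (by simp))
      exact (continuous_const.sub continuous_id).continuousAt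
    have := h.tendsto.mono_left (nhdsWithin_le_nhds (s := Ioi 0))
    simpa using this
  · filter_upwards [self_mem_nhdsWithin, nhdsWithin_le_nhds (Iio_mem_nhds zero_lt_one)]
      with c hc hc1
    have hc2 : 0 < 1 - c := tsub_pos_of_lt hc1
    exact mul_pos (show 0 < c from hc) (inv_pos.2 hc2)

/-- On sufficiently flat sets the horizontal projection scales surface measure by at most any factor
`M > |ν_d|`. -/
theorem eventually_volume_horiz_image_le {m : ℕ} {ν : Space m} (hν : ‖ν‖ = 1) {M : NNReal}
    (hM : ENNReal.ofReal |ν (Fin.last m)| < M) :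
    ∀ᶠ c : NNReal in 𝓝[>] 0, ∀ B : Set (Space m),
      (∀ q ∈ B, ∀ q' ∈ B, |inner ℝ ν (q - q')| ≤ c * ‖q - q'‖) →
      volume (horiz m '' B) ≤ M * (μHE[m] : Measure (Space m)) B := by
  obtain ⟨T, hT, h⟩ := exists_approximatesLinearOn_of_flat hν
  have h1 := addHaar_image_le_mul_of_det_lt volume T (hT ▸ hM)
  filter_upwards [tendsto_mul_inv_one_sub_nhdsGT.eventually h1,
    nhdsWithin_le_nhds (Iio_mem_nhds zero_lt_one)] with c hc hc1 B hB
  obtain ⟨D, f, hf, hfD, hD, -⟩ := h c hc1 B hB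
  rw [← hfD]
  exact (hc D f hf).trans (by gcongr)

/-- On sufficiently flat sets the horizontal projection scales surface measure by at least any factor
`M < |ν_d|`. -/
theorem eventually_le_volume_horiz_image {m : ℕ} {ν : Space m} (hν : ‖ν‖ = 1) {M : NNReal}
    (hM : (M : ENNReal) < ENNReal.ofReal |ν (Fin.last m)|) :
    ∀ᶠ c : NNReal in 𝓝[>] 0, ∀ B : Set (Space m),
      (∀ q ∈ B, ∀ q' ∈ B, |inner ℝ ν (q - q')| ≤ c * ‖q - q'‖) →
      M * (μHE[m] : Measure (Space m)) B ≤ volume (horiz m '' B) := by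
  obtain ⟨T, hT, h⟩ := exists_approximatesLinearOn_of_flat hν
  obtain ⟨M', hMM', hM'⟩ := ENNReal.lt_iff_exists_nnreal_btwn.1 hM
  have h1 := mul_le_addHaar_image_of_lt_det volume T (hT ▸ hM')
  have h2 : Filter.Tendsto (fun c : NNReal => M * (1 - c)⁻¹ ^ m) (𝓝[>] 0) (𝓝 M) := by
    have h : ContinuousAt (fun c : NNReal => M * (1 - c)⁻¹ ^ m) 0 := by
      refine continuousAt_const.mul ((ContinuousAt.inv₀ ?_ (by simp)).pow m)
      exact (continuous_const.sub continuous_id).continuousAt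
    simpa using h.tendsto.mono_left (nhdsWithin_le_nhds (s := Ioi 0))
  filter_upwards [tendsto_mul_inv_one_sub_nhdsGT.eventually h1,
    h2.eventually_lt_const (ENNReal.coe_lt_coe.1 hMM'),
    nhdsWithin_le_nhds (Iio_mem_nhds zero_lt_one)] with c hc hcM hc1 B hB
  obtain ⟨D, f, hf, hfD, -, hD⟩ := h c hc1 B hB
  calc (M : ENNReal) * (μHE[m] : Measure (Space m)) B
      ≤ M * ((((1 - c)⁻¹ : NNReal) : ENNReal) ^ m * volume D) := by gcongr
    _ = ((M * (1 - c)⁻¹ ^ m : NNReal) : ENNReal) * volume D := by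
        rw [← mul_assoc]; push_cast; rfl
    _ ≤ M' * volume D := by gcongr
    _ ≤ volume (horiz m '' B) := hfD ▸ hc D f hf

/-! ### The regular part of the boundary -/

/-- The regular points of the topological boundary of `U`. -/
def regularFrontier {m : ℕ} (U : Set (Space m)) : Set (Space m) := frontier U ∩ regularBoundary U

theorem eventually_frontier_imp_eq_zero {m : ℕ} {U : Set (Space m)} {p : Space m}
    {φ : Space m → ℝ} (hφ : ContDiffAt ℝ 1 φ p) (hU : ∀ᶠ x in 𝓝 p, x ∈ U ↔ φ x < 0) :
    ∀ᶠ q in 𝓝 p, q ∈ frontier U → φ q = 0 := by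
  filter_upwards [hφ.eventually (by simp), eventually_eventually_nhds.2 hU] with q hq hqU hqf
  -- where `φ ≠ 0`, the point is interior to `U` or to its complement
  rcases lt_trichotomy (φ q) 0 with h | h | h
  · refine absurd ?_ hqf.2
    rw [mem_interior_iff_mem_nhds]
    filter_upwards [hqU, hq.continuousAt.eventually_lt_const h] with x hx hx' using hx.2 hx'
  · exact h
  · refine absurd hqf.1 ?_
    rw [mem_closure_iff_frequently, Filter.not_frequently]
    filter_upwards [hqU, hq.continuousAt.eventually_const_lt h] with x hx hx' hxU
    exact absurd (hx.1 hxU) (not_lt.2 hx'.le)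

theorem IsOutwardUnitNormal.norm_eq_one {m : ℕ} {U : Set (Space m)} {p ν : Space m}
    (h : IsOutwardUnitNormal U p ν) : ‖ν‖ = 1 := by
  obtain ⟨φ, -, -, h0, -, rfl⟩ := h
  rw [norm_smul, norm_inv, norm_norm, inv_mul_cancel₀ (norm_ne_zero_iff.2 h0)]

theorem isOutwardUnitNormal_outwardNormal {m : ℕ} {U : Set (Space m)} {p : Space m}
    (h : p ∈ regularBoundary U) : IsOutwardUnitNormal U p (outwardNormal U p) := by
  obtain ⟨ν, hν⟩ := h
  rwa [hν.outwardNormal_eq]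

/-- Near a regular point the boundary is flat at every scale, in the direction of the normal. -/
theorem IsOutwardUnitNormal.exists_nhds_flat {m : ℕ} {U : Set (Space m)} {p ν : Space m}
    (h : IsOutwardUnitNormal U p ν) {c : NNReal} (hc : 0 < c) :
    ∃ N ∈ 𝓝 p, ∀ q ∈ frontier U ∩ N, ∀ q' ∈ frontier U ∩ N,
      |inner ℝ ν (q - q')| ≤ c * ‖q - q'‖ := by
  obtain ⟨φ, hφ, -, hg, hU, rfl⟩ := h
  have hg' : 0 < ‖gradient φ p‖ := norm_pos_iff.2 hg
  have hs := hφ.hasStrictFDerivAt (by norm_num)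
  obtain ⟨s, hs, happ⟩ := hs.approximates_deriv_on_nhds (c := c * ‖gradient φ p‖₊)
    (Or.inr (mul_pos hc (by exact_mod_cast hg')))
  refine ⟨_, Filter.inter_mem hs (eventually_frontier_imp_eq_zero hφ hU), ?_⟩
  rintro q ⟨hq, hqs, hq0⟩ q' ⟨hq', hqs', hq0'⟩
  have h1 := happ q hqs q' hqs'
  rw [hq0 hq, hq0' hq', sub_zero, zero_sub, norm_neg, Real.norm_eq_abs] at h1
  have h2 : fderiv ℝ φ p (q - q') = inner ℝ (gradient φ p) (q - q') := by simp [gradient]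
  rw [h2, NNReal.coe_mul, coe_nnnorm] at h1
  rw [real_inner_smul_left, abs_mul, abs_inv, abs_norm, inv_mul_le_iff₀ hg']
  linarith

/-- Near a regular point all boundary points are regular, with a normal continuous at that point. -/
theorem eventually_isOutwardUnitNormal {m : ℕ} {U : Set (Space m)} {p : Space m}
    (h : p ∈ regularBoundary U) :
    ∃ ν : Space m → Space m, ContinuousAt ν p ∧
      ∀ᶠ q in 𝓝 p, q ∈ frontier U → IsOutwardUnitNormal U q (ν q) := by
  obtain ⟨_, φ, hφ, -, hg, hU, -⟩ := h
  have hcont : ContinuousAt (gradient φ) p :=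
    (InnerProductSpace.toDual ℝ (Space m)).symm.continuous.continuousAt.comp
      (hφ.fderiv_right (m := 0) (by norm_num)).continuousAt
  refine ⟨fun q => ‖gradient φ q‖⁻¹ • gradient φ q,
    (hcont.norm.inv₀ (norm_ne_zero_iff.2 hg)).smul hcont, ?_⟩
  filter_upwards [hφ.eventually (by simp), eventually_eventually_nhds.2 hU,
    eventually_frontier_imp_eq_zero hφ hU, hcont.eventually_ne hg] with q h1 h2 h3 h4 hq
  exact ⟨φ, h1, h3 hq, h4, h2, rfl⟩

theorem continuousOn_outwardNormal {m : ℕ} (U : Set (Space m)) :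
    ContinuousOn (outwardNormal U) (regularFrontier U) := by
  rintro p ⟨hp, hpr⟩
  obtain ⟨ν, hν, h⟩ := eventually_isOutwardUnitNormal hpr
  refine hν.continuousWithinAt.congr_of_eventuallyEq ?_ (h.self_of_nhds hp).outwardNormal_eq
  filter_upwards [self_mem_nhdsWithin, nhdsWithin_le_nhds h] with q hq hq'
  exact (hq' hq.1).outwardNormal_eq

theorem measurableSet_regularFrontier {m : ℕ} (U : Set (Space m)) :
    MeasurableSet (regularFrontier U) := by
  have h : regularFrontier U
      = frontier U ∩ interior {q | q ∈ frontier U → q ∈ regularBoundary U} := by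
    ext p
    refine ⟨fun hp => ⟨hp.1, ?_⟩, fun hp => ⟨hp.1, interior_subset hp.2 hp.1⟩⟩
    obtain ⟨ν, -, h⟩ := eventually_isOutwardUnitNormal hp.2
    rw [mem_interior_iff_mem_nhds]
    filter_upwards [h] with q hq hqf using ⟨_, hq hqf⟩
  rw [h]
  exact isClosed_frontier.measurableSet.inter isOpen_interior.measurableSet

/-- The vertical component of the outward normal, extended by zero off the regular boundary. -/
noncomputable def normalHeight {m : ℕ} (U : Set (Space m)) : Space m → ℝ :=
  (regularFrontier U).indicator fun x => outwardNormal U x (Fin.last m)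

theorem normalHeight_of_mem {m : ℕ} {U : Set (Space m)} {x : Space m}
    (hx : x ∈ regularFrontier U) : normalHeight U x = outwardNormal U x (Fin.last m) :=
  indicator_of_mem hx _

theorem measurable_normalHeight {m : ℕ} (U : Set (Space m)) : Measurable (normalHeight U) := by
  classical
  unfold normalHeight
  rw [← piecewise_eq_indicator]
  refine ContinuousOn.measurable_piecewise ?_ continuousOn_const (measurableSet_regularFrontier U)
  exact (EuclideanSpace.proj (𝕜 := ℝ) (Fin.last m)).continuous.comp_continuousOn
    (continuousOn_outwardNormal U)

theorem abs_normalHeight_le {m : ℕ} (U : Set (Space m)) (x : Space m) :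
    |normalHeight U x| ≤ 1 := by
  by_cases hx : x ∈ regularFrontier U
  · rw [normalHeight_of_mem hx, ← Real.norm_eq_abs,
      ← (isOutwardUnitNormal_outwardNormal hx.2).norm_eq_one]
    exact PiLp.norm_apply_le _ _
  · simp [normalHeight, hx]

/-! ### The area formula for the horizontal projection of the boundary -/

/-- A Lindelöf argument: a set that locally has a hereditary property is covered by countably many
disjoint measurable sets with this property. -/
theorem exists_measurable_disjoint_cover {α : Type*} [TopologicalSpace α]
    [SecondCountableTopology α] [MeasurableSpace α] [OpensMeasurableSpace α] {P : Set α → Prop}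
    (h0 : P ∅) (hmono : ∀ ⦃s t⦄, s ⊆ t → P t → P s) {s : Set α} (hs : ∀ x ∈ s, ∃ N ∈ 𝓝 x, P N) :
    ∃ f : ℕ → Set α, (∀ k, MeasurableSet (f k)) ∧ Pairwise (Function.onFun Disjoint f) ∧
      s ⊆ ⋃ k, f k ∧ ∀ k, P (f k) := by
  choose! N hN hP using hs
  obtain ⟨t, hts, htc, hst⟩ := TopologicalSpace.countable_cover_nhdsWithin
    (f := fun x => interior (N x)) (s := s)
    fun x hx => nhdsWithin_le_nhds (interior_mem_nhds.2 (hN x hx))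
  rcases t.eq_empty_or_nonempty with rfl | hne
  · refine ⟨fun _ => ∅, fun _ => MeasurableSet.empty, fun _ _ _ => disjoint_bot_left, ?_,
      fun _ => h0⟩
    simpa using hst
  · obtain ⟨x, hx⟩ := htc.exists_eq_range hne
    refine ⟨disjointed fun k => interior (N (x k)), fun k => ?_, disjoint_disjointed _, ?_,
      fun k => ?_⟩
    · exact MeasurableSet.disjointed (fun _ => isOpen_interior.measurableSet) k
    · rw [iUnion_disjointed]
      refine hst.trans ?_
      rw [hx, biUnion_range]
    · refine hmono ((disjointed_subset _ k).trans interior_subset) (hP (x k) (hts ?_))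
      rw [hx]
      exact mem_range_self k

/-- The area formula near a regular point, up to an error proportional to the surface measure. -/
theorem exists_nhds_volume_horiz_image_close {m : ℕ} {U : Set (Space m)} {p : Space m}
    (hp : p ∈ regularFrontier U) {ε : NNReal} (hε : 0 < ε) :
    ∃ N ∈ 𝓝 p, ∀ B ⊆ regularFrontier U ∩ N, MeasurableSet B →
      volume (horiz m '' B) ≤ ∫⁻ x in B, ENNReal.ofReal |normalHeight U x| ∂μHE[m]
        + ε * (μHE[m] : Measure (Space m)) B ∧
      ∫⁻ x in B, ENNReal.ofReal |normalHeight U x| ∂μHE[m] ≤ volume (horiz m '' B)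
        + ε * (μHE[m] : Measure (Space m)) B := by
  have hn := isOutwardUnitNormal_outwardNormal hp.2
  set ν := outwardNormal U p with hν
  set b : ℝ := |ν (Fin.last m)| with hb
  have hb0 : 0 ≤ b := abs_nonneg _
  have hε' : (0 : ℝ) < ε := hε
  -- the two sides of the slope bound, with the trivial lower bound where `ν` is almost horizontal
  have hup := eventually_volume_horiz_image_le hn.norm_eq_one
    (M := (b + ε / 2).toNNReal) (by
      rw [← ENNReal.ofReal, ENNReal.ofReal_lt_ofReal_iff (by positivity)]
      linarith)
  have hlow : ∀ᶠ c : NNReal in 𝓝[>] 0, ∀ B : Set (Space m),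
      (∀ q ∈ B, ∀ q' ∈ B, |inner ℝ ν (q - q')| ≤ c * ‖q - q'‖) →
      ENNReal.ofReal (b - ε / 2) * (μHE[m] : Measure (Space m)) B ≤ volume (horiz m '' B) := by
    by_cases h : b - ε / 2 ≤ 0
    · filter_upwards with c B _
      simp [ENNReal.ofReal_of_nonpos h]
    · refine eventually_le_volume_horiz_image hn.norm_eq_one ?_
      rw [← ENNReal.ofReal, ENNReal.ofReal_lt_ofReal_iff (by linarith)]
      linarith
  obtain ⟨c, hup, hlow, hc⟩ := (hup.and (hlow.and self_mem_nhdsWithin)).exists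
  obtain ⟨N, hN, hflat⟩ := hn.exists_nhds_flat (show 0 < c from hc)
  obtain ⟨ν', hν', hev⟩ := eventually_isOutwardUnitNormal hp.2
  have hνp : ν' p = ν := (hev.self_of_nhds hp.1).outwardNormal_eq.symm
  have hcont : ContinuousAt (fun q => |ν' q (Fin.last m)|) p :=
    ((EuclideanSpace.proj (𝕜 := ℝ) (Fin.last m)).continuous.continuousAt.comp hν').abs
  have hnear : ∀ᶠ q in 𝓝 p, |(|ν' q (Fin.last m)|) - b| < ε / 2 := by
    have := Metric.tendsto_nhds.1 hcont.tendsto (ε / 2) (by positivity)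
    simpa only [hνp, Real.dist_eq] using this
  refine ⟨_, Filter.inter_mem hN (Filter.inter_mem hev hnear), fun B hB hBm => ?_⟩
  have hB1 : ∀ q ∈ B, ∀ q' ∈ B, |inner ℝ ν (q - q')| ≤ c * ‖q - q'‖ := fun q hq q' hq' =>
    hflat q ⟨(hB hq).1.1, (hB hq).2.1⟩ q' ⟨(hB hq').1.1, (hB hq').2.1⟩
  have hB2 : ∀ q ∈ B, |(|normalHeight U q|) - b| < ε / 2 := fun q hq => by
    have h := hB hq
    rw [normalHeight_of_mem h.1, (h.2.2.1 h.1.1).outwardNormal_eq]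
    exact h.2.2.2
  have hint : ∫⁻ x in B, ENNReal.ofReal |normalHeight U x| ∂μHE[m]
      + ε * (μHE[m] : Measure (Space m)) B
      = ∫⁻ x in B, (ENNReal.ofReal |normalHeight U x| + ε) ∂μHE[m] := by
    rw [lintegral_add_right _ measurable_const, setLIntegral_const]
  constructor
  · rw [hint]
    refine (hup B hB1).trans ?_
    rw [← setLIntegral_const]
    refine setLIntegral_mono' hBm fun x hx => ?_
    have := abs_lt.1 (hB2 x hx)
    rw [← ENNReal.ofReal, ← ENNReal.ofReal_coe_nnreal, ← ENNReal.ofReal_add (abs_nonneg _) hε'.le]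
    exact ENNReal.ofReal_le_ofReal (by linarith)
  · calc ∫⁻ x in B, ENNReal.ofReal |normalHeight U x| ∂μHE[m]
        ≤ ∫⁻ _ in B, (ENNReal.ofReal (b - ε / 2) + ε) ∂μHE[m] := by
          refine setLIntegral_mono' hBm fun x hx => ?_
          have := abs_lt.1 (hB2 x hx)
          rw [← ENNReal.ofReal_coe_nnreal (p := ε)]
          refine le_trans (ENNReal.ofReal_le_ofReal ?_) ENNReal.ofReal_add_le
          linarith
      _ = ENNReal.ofReal (b - ε / 2) * (μHE[m] : Measure (Space m)) B
          + ε * (μHE[m] : Measure (Space m)) B := by rw [setLIntegral_const, add_mul]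
      _ ≤ _ := by gcongr; exact hlow B hB1

theorem ennreal_le_of_forall_le_add_mul {a b s : ENNReal} (hs : s ≠ ⊤)
    (h : ∀ ε : NNReal, 0 < ε → a ≤ b + ε * s) : a ≤ b := by
  refine ENNReal.le_of_forall_pos_le_add fun δ hδ _ => ?_
  obtain ⟨n, hn, hn'⟩ := ENNReal.exists_nnreal_pos_mul_lt hs
    (ENNReal.coe_ne_zero.2 hδ.ne')
  exact (h n hn).trans (by gcongr)

theorem exists_cover_volume_horiz_image_close {m : ℕ} (U : Set (Space m)) {ε : NNReal}
    (hε : 0 < ε) :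
    ∃ f : ℕ → Set (Space m), (∀ k, MeasurableSet (f k)) ∧ Pairwise (Function.onFun Disjoint f) ∧
      regularFrontier U ⊆ ⋃ k, f k ∧ ∀ k, ∀ B ⊆ regularFrontier U ∩ f k, MeasurableSet B →
      volume (horiz m '' B) ≤ ∫⁻ x in B, ENNReal.ofReal |normalHeight U x| ∂μHE[m]
        + ε * (μHE[m] : Measure (Space m)) B ∧
      ∫⁻ x in B, ENNReal.ofReal |normalHeight U x| ∂μHE[m] ≤ volume (horiz m '' B)
        + ε * (μHE[m] : Measure (Space m)) B := by
  refine exists_measurable_disjoint_cover (P := fun N => ∀ B ⊆ regularFrontier U ∩ N,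
      MeasurableSet B →
      volume (horiz m '' B) ≤ ∫⁻ x in B, ENNReal.ofReal |normalHeight U x| ∂μHE[m]
        + ε * (μHE[m] : Measure (Space m)) B ∧
      ∫⁻ x in B, ENNReal.ofReal |normalHeight U x| ∂μHE[m] ≤ volume (horiz m '' B)
        + ε * (μHE[m] : Measure (Space m)) B) ?_ ?_
    fun p hp => exists_nhds_volume_horiz_image_close hp hε
  · intro B hB _
    rw [inter_empty, subset_empty_iff] at hB
    simp [hB]
  · intro s t hst ht B hB
    exact ht B (hB.trans (inter_subset_inter_right _ hst))

/-- One half of the area formula, valid without injectivity because the projected pieces may overlap.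
In particular the boundary points with horizontal normal project onto a null set. -/
theorem volume_horiz_image_le {m : ℕ} {U : Set (Space m)}
    (hU : (μHE[m] : Measure (Space m)) (frontier U) < ⊤) {B : Set (Space m)}
    (hB : B ⊆ regularFrontier U) (hBm : MeasurableSet B) :
    volume (horiz m '' B) ≤ ∫⁻ x in B, ENNReal.ofReal |normalHeight U x| ∂μHE[m] := by
  have hfin : (μHE[m] : Measure (Space m)) B ≠ ⊤ :=
    ((measure_mono (hB.trans inter_subset_left)).trans_lt hU).ne
  refine ennreal_le_of_forall_le_add_mul hfin fun ε hε => ?_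
  obtain ⟨f, hfm, hfd, hcov, hf⟩ := exists_cover_volume_horiz_image_close U hε
  have hBf : B = ⋃ k, B ∩ f k := by rw [← inter_iUnion, inter_eq_self_of_subset_left (hB.trans hcov)]
  have hd : Pairwise (Function.onFun Disjoint fun k => B ∩ f k) := fun i j hij =>
    (hfd hij).mono inter_subset_right inter_subset_right
  have hm : ∀ k, MeasurableSet (B ∩ f k) := fun k => hBm.inter (hfm k)
  calc volume (horiz m '' B) = volume (⋃ k, horiz m '' (B ∩ f k)) := by
        rw [← image_iUnion, ← hBf]
    _ ≤ ∑' k, volume (horiz m '' (B ∩ f k)) := measure_iUnion_le _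
    _ ≤ ∑' k, (∫⁻ x in B ∩ f k, ENNReal.ofReal |normalHeight U x| ∂μHE[m]
        + ε * (μHE[m] : Measure (Space m)) (B ∩ f k)) := ENNReal.tsum_le_tsum fun k =>
          (hf k _ (inter_subset_inter_left _ hB) (hm k)).1
    _ = _ := by
        rw [ENNReal.tsum_add, ENNReal.tsum_mul_left, ← lintegral_iUnion hm hd,
          ← measure_iUnion hd hm, ← hBf]

/-- The area formula on pieces of the boundary that are graphs over the horizontal hyperplane. -/
theorem volume_horiz_image_eq {m : ℕ} {U : Set (Space m)}
    (hU : (μHE[m] : Measure (Space m)) (frontier U) < ⊤) {B : Set (Space m)}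
    (hB : B ⊆ regularFrontier U) (hBm : MeasurableSet B) (hinj : InjOn (horiz m) B) :
    volume (horiz m '' B) = ∫⁻ x in B, ENNReal.ofReal |normalHeight U x| ∂μHE[m] := by
  refine le_antisymm (volume_horiz_image_le hU hB hBm) ?_
  have hfin : (μHE[m] : Measure (Space m)) B ≠ ⊤ :=
    ((measure_mono (hB.trans inter_subset_left)).trans_lt hU).ne
  refine ennreal_le_of_forall_le_add_mul hfin fun ε hε => ?_
  obtain ⟨f, hfm, hfd, hcov, hf⟩ := exists_cover_volume_horiz_image_close U hε
  have hBf : B = ⋃ k, B ∩ f k := by rw [← inter_iUnion, inter_eq_self_of_subset_left (hB.trans hcov)]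
  have hd : Pairwise (Function.onFun Disjoint fun k => B ∩ f k) := fun i j hij =>
    (hfd hij).mono inter_subset_right inter_subset_right
  have hm : ∀ k, MeasurableSet (B ∩ f k) := fun k => hBm.inter (hfm k)
  have hd' : Pairwise (Function.onFun Disjoint fun k => horiz m '' (B ∩ f k)) := fun i j hij =>
    disjoint_image_image fun x hx y hy hxy =>
      (hd hij).ne_of_mem hx hy (hinj hx.1 hy.1 hxy)
  have hm' : ∀ k, MeasurableSet (horiz m '' (B ∩ f k)) := fun k =>
    (hm k).image_of_continuousOn_injOn (horiz m).continuous.continuousOn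
      (hinj.mono inter_subset_left)
  calc ∫⁻ x in B, ENNReal.ofReal |normalHeight U x| ∂μHE[m]
      = ∑' k, ∫⁻ x in B ∩ f k, ENNReal.ofReal |normalHeight U x| ∂μHE[m] := by
        rw [← lintegral_iUnion hm hd, ← hBf]
    _ ≤ ∑' k, (volume (horiz m '' (B ∩ f k)) + ε * (μHE[m] : Measure (Space m)) (B ∩ f k)) :=
        ENNReal.tsum_le_tsum fun k => (hf k _ (inter_subset_inter_left _ hB) (hm k)).2
    _ = _ := by
        rw [ENNReal.tsum_add, ENNReal.tsum_mul_left, ← measure_iUnion hd' hm',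
          ← measure_iUnion hd hm, ← image_iUnion, ← hBf]

/-! ### Integration over the boundary along vertical lines -/

/-- The point of `ℝ^(m+1)` with horizontal part `y` and height `t`. -/
noncomputable def join {m : ℕ} (y : EuclideanSpace ℝ (Fin m)) (t : ℝ) : Space m :=
  WithLp.toLp 2 (Fin.snoc (α := fun _ => ℝ) y t)

@[simp] theorem join_last {m : ℕ} (y : EuclideanSpace ℝ (Fin m)) (t : ℝ) :
    join y t (Fin.last m) = t := by simp [join]

@[simp] theorem join_castSucc {m : ℕ} (y : EuclideanSpace ℝ (Fin m)) (t : ℝ) (i : Fin m) :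
    join y t i.castSucc = y i := by simp [join]

@[simp] theorem horiz_join {m : ℕ} (y : EuclideanSpace ℝ (Fin m)) (t : ℝ) :
    horiz m (join y t) = y := by ext i; simp

@[simp] theorem join_horiz {m : ℕ} (x : Space m) : join (horiz m x) (x (Fin.last m)) = x := by
  ext i
  induction i using Fin.lastCases <;> simp

theorem join_sub_join {m : ℕ} (y : EuclideanSpace ℝ (Fin m)) (s t : ℝ) :
    join y s - join y t = EuclideanSpace.single (Fin.last m) (s - t) := by
  ext i
  induction i using Fin.lastCases with
  | last => simp
  | cast i => simp [(Fin.castSucc_lt_last i).ne]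

theorem join_eq_add_smul {m : ℕ} (y : EuclideanSpace ℝ (Fin m)) (t : ℝ) :
    join y t = join y 0 + t • EuclideanSpace.single (Fin.last m) 1 := by
  have := join_sub_join y t 0
  rw [sub_zero] at this
  rw [← sub_eq_iff_eq_add', this]
  ext i
  simp

theorem hasDerivAt_join {m : ℕ} (y : EuclideanSpace ℝ (Fin m)) (t : ℝ) :
    HasDerivAt (join y) (EuclideanSpace.single (Fin.last m) 1) t := by
  have h : (join y) = fun t => join y 0 + t • EuclideanSpace.single (Fin.last m) 1 :=
    funext fun t => join_eq_add_smul y t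
  rw [h]
  simpa using ((hasDerivAt_id t).smul_const
    (EuclideanSpace.single (Fin.last m) (1 : ℝ))).const_add (join y 0)

theorem continuous_join {m : ℕ} (y : EuclideanSpace ℝ (Fin m)) : Continuous (join y) :=
  continuous_iff_continuousAt.2 fun t => (hasDerivAt_join y t).continuousAt

theorem inner_single_last {m : ℕ} (x : Space m) (s : ℝ) :
    inner ℝ x (EuclideanSpace.single (Fin.last m) s) = s * x (Fin.last m) := by
  simp [EuclideanSpace.inner_single_right]

theorem exists_nhds_injOn_horiz {m : ℕ} {U : Set (Space m)} {p : Space m}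
    (hp : normalHeight U p ≠ 0) : ∃ N ∈ 𝓝 p, InjOn (horiz m) (frontier U ∩ N) := by
  have hpr : p ∈ regularFrontier U := mem_of_indicator_ne_zero hp
  have hn := isOutwardUnitNormal_outwardNormal hpr.2
  rw [normalHeight_of_mem hpr] at hp
  have hp' : 0 < |outwardNormal U p (Fin.last m)| := abs_pos.2 hp
  obtain ⟨N, hN, h⟩ := hn.exists_nhds_flat
    (c := (|outwardNormal U p (Fin.last m)| / 2).toNNReal) (by simpa using hp)
  refine ⟨N, hN, fun q hq q' hq' hqq => ?_⟩
  -- two points on the same vertical line violate flatness at scale `|ν_d| / 2` unless they agree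
  have h1 := h q hq q' hq'
  rw [← join_horiz q, ← join_horiz q', hqq, join_sub_join, inner_single_last,
    PiLp.norm_single, abs_mul, Real.coe_toNNReal _ (by positivity),
    Real.norm_eq_abs] at h1
  have h2 : |q (Fin.last m) - q' (Fin.last m)| = 0 := by
    by_contra hne
    have : 0 < |q (Fin.last m) - q' (Fin.last m)| := lt_of_le_of_ne (abs_nonneg _) (Ne.symm hne)
    nlinarith
  rw [← join_horiz q, ← join_horiz q', hqq, sub_eq_zero.1 (abs_eq_zero.1 h2)]

theorem tsum_indicator_join {m : ℕ} {α : Type*} [AddCommMonoid α] [TopologicalSpace α]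
    {E : Set (Space m)} (hE : InjOn (horiz m) E) (h : Space m → α) {x : Space m} (hx : x ∈ E) :
    ∑' t : ℝ, E.indicator h (join (horiz m x) t) = h x := by
  rw [tsum_eq_single (x (Fin.last m))]
  · rw [join_horiz, indicator_of_mem hx]
  · intro t ht
    refine indicator_of_notMem (fun hmem => ht ?_) _
    have := hE hmem hx (by simp)
    rw [← this, join_last]

theorem tsum_indicator_join_eq_zero {m : ℕ} {α : Type*} [AddCommMonoid α] [TopologicalSpace α]
    {E : Set (Space m)} (h : Space m → α) {y : EuclideanSpace ℝ (Fin m)} (hy : y ∉ horiz m '' E) :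
    ∑' t : ℝ, E.indicator h (join y t) = 0 := by
  rw [← tsum_zero (α := α) (β := ℝ)]
  refine tsum_congr fun t => indicator_of_notMem (fun hmem => hy ⟨_, hmem, by simp⟩) _

/-- The area formula for a function supported on a piece of the boundary that is a graph. -/
theorem lintegral_mul_normalHeight_of_injOn {m : ℕ} {U : Set (Space m)}
    (hU : (μHE[m] : Measure (Space m)) (frontier U) < ⊤) {E : Set (Space m)}
    (hE : E ⊆ regularFrontier U) (hEm : MeasurableSet E) (hinj : InjOn (horiz m) E)
    {h : Space m → ENNReal} (hh : Measurable h) :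
    (Measurable fun y => ∑' t : ℝ, E.indicator h (join y t)) ∧
    ∫⁻ x in E, h x * ENNReal.ofReal |normalHeight U x| ∂μHE[m]
      = ∫⁻ y, ∑' t : ℝ, E.indicator h (join y t) := by
  have hπ : Measurable (horiz m) := (horiz m).continuous.measurable
  have ha : Measurable fun x => ENNReal.ofReal |normalHeight U x| :=
    ENNReal.measurable_ofReal.comp (measurable_normalHeight U).abs
  have hemb : MeasurableEmbedding (fun x : E => horiz m x) := by
    have := hEm.standardBorel
    exact (hπ.comp measurable_subtype_coe).measurableEmbedding
      fun x y hxy => Subtype.ext (hinj x.2 y.2 hxy)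
  have hH : Measurable fun y => ∑' t : ℝ, E.indicator h (join y t) := by
    have heq : (fun y => ∑' t : ℝ, E.indicator h (join y t))
        = Function.extend (fun x : E => horiz m x) (fun x : E => h x) 0 := by
      ext y
      by_cases hy : ∃ x : E, horiz m x = y
      · obtain ⟨x, rfl⟩ := hy
        rw [hemb.injective.extend_apply, tsum_indicator_join hinj h x.2]
      · rw [Function.extend_apply' _ _ _ hy, tsum_indicator_join_eq_zero h]
        · rfl
        · rintro ⟨x, hx, rfl⟩
          exact hy ⟨⟨x, hx⟩, rfl⟩
    rw [heq]
    exact hemb.measurable_extend (hh.comp measurable_subtype_coe) measurable_zero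
  refine ⟨hH, ?_⟩
  have him : MeasurableSet (horiz m '' E) :=
    hEm.image_of_continuousOn_injOn (horiz m).continuous.continuousOn hinj
  have hmap : Measure.map (horiz m)
      (((μHE[m] : Measure (Space m)).withDensity fun x => ENNReal.ofReal |normalHeight U x|).restrict
        E) = volume.restrict (horiz m '' E) := by
    ext C hC
    have hCm : MeasurableSet (E ∩ horiz m ⁻¹' C) := hEm.inter (hπ hC)
    rw [Measure.map_apply hπ hC, Measure.restrict_apply (hπ hC), Measure.restrict_apply hC,
      inter_comm, withDensity_apply _ hCm, ← volume_horiz_image_eq hU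
        (inter_subset_left.trans hE) hCm (hinj.mono inter_subset_left), image_inter_preimage,
      inter_comm]
  calc ∫⁻ x in E, h x * ENNReal.ofReal |normalHeight U x| ∂μHE[m]
      = ∫⁻ x in E, (∑' t : ℝ, E.indicator h (join (horiz m x) t))
          * ENNReal.ofReal |normalHeight U x| ∂μHE[m] :=
        setLIntegral_congr_fun hEm fun x hx => by
          simp only [tsum_indicator_join hinj h hx]
    _ = ∫⁻ x in E, (∑' t : ℝ, E.indicator h (join (horiz m x) t))
          ∂(μHE[m] : Measure (Space m)).withDensity fun x => ENNReal.ofReal |normalHeight U x| := by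
        refine Eq.trans ?_ (setLIntegral_withDensity_eq_setLIntegral_mul _ ha (hH.comp hπ) hEm).symm
        exact lintegral_congr fun x => mul_comm _ _
    _ = ∫⁻ y in horiz m '' E, ∑' t : ℝ, E.indicator h (join y t) := by
        rw [← hmap, lintegral_map hH hπ]
    _ = ∫⁻ y, ∑' t : ℝ, E.indicator h (join y t) :=
        setLIntegral_eq_of_support_subset fun y hy => by
          by_contra hne
          exact hy (tsum_indicator_join_eq_zero h hne)

/-- The area formula for the horizontal projection of the boundary, in the form of an integral over
vertical lines. -/
theorem lintegral_mul_normalHeight {m : ℕ} {U : Set (Space m)}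
    (hU : (μHE[m] : Measure (Space m)) (frontier U) < ⊤) {Γ : Set (Space m)}
    (hΓ : ∀ x ∈ Γ, normalHeight U x ≠ 0) (hΓm : MeasurableSet Γ)
    {h : Space m → ENNReal} (hh : Measurable h) :
    (Measurable fun y => ∑' t : ℝ, Γ.indicator h (join y t)) ∧
    ∫⁻ x in Γ, h x * ENNReal.ofReal |normalHeight U x| ∂μHE[m]
      = ∫⁻ y, ∑' t : ℝ, Γ.indicator h (join y t) := by
  have hΓr : Γ ⊆ regularFrontier U := fun x hx => mem_of_indicator_ne_zero (hΓ x hx)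
  obtain ⟨f, hfm, hfd, hcov, hf⟩ := exists_measurable_disjoint_cover
    (P := fun N => InjOn (horiz m) (frontier U ∩ N)) (by simp)
    (fun s t hst ht => ht.mono (inter_subset_inter_right _ hst))
    (s := Γ) fun x hx => exists_nhds_injOn_horiz (hΓ x hx)
  have hΓf : Γ = ⋃ k, Γ ∩ f k := by rw [← inter_iUnion, inter_eq_self_of_subset_left hcov]
  have hd : Pairwise (Function.onFun Disjoint fun k => Γ ∩ f k) := fun i j hij =>
    (hfd hij).mono inter_subset_right inter_subset_right
  have hm : ∀ k, MeasurableSet (Γ ∩ f k) := fun k => hΓm.inter (hfm k)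
  have hk := fun k => lintegral_mul_normalHeight_of_injOn hU
    (E := Γ ∩ f k) (inter_subset_left.trans hΓr) (hm k)
    ((hf k).mono (inter_subset_inter_left _ (hΓr.trans inter_subset_left))) hh
  have hsum : ∀ y, ∑' t : ℝ, Γ.indicator h (join y t)
      = ∑' k, ∑' t : ℝ, (Γ ∩ f k).indicator h (join y t) := fun y => by
    rw [ENNReal.tsum_comm]
    refine tsum_congr fun t => ?_
    conv_lhs => rw [hΓf]
    by_cases hx : join y t ∈ ⋃ k, Γ ∩ f k
    · obtain ⟨k, hxk⟩ := mem_iUnion.1 hx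
      rw [indicator_of_mem hx, tsum_eq_single k, indicator_of_mem hxk]
      intro j hj
      exact indicator_of_notMem (fun hxj => (hd hj).ne_of_mem hxj hxk rfl) _
    · rw [indicator_of_notMem hx]
      refine (ENNReal.tsum_eq_zero.2 fun k => indicator_of_notMem (fun hxk => hx ?_) _).symm
      exact mem_iUnion.2 ⟨k, hxk⟩
  simp_rw [hsum]
  refine ⟨Measurable.tsum fun k => (hk k).1, ?_⟩
  rw [lintegral_tsum fun k => (hk k).1.aemeasurable]
  conv_lhs => rw [hΓf]
  rw [lintegral_iUnion hm hd]
  exact tsum_congr fun k => (hk k).2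

/-- Almost every vertical line meets the boundary at regular points only, and transversally. -/
theorem ae_normalHeight_ne_zero {m : ℕ} {U : Set (Space m)} (hU : IsPiecewiseC1Domain U) :
    ∀ᵐ y : EuclideanSpace ℝ (Fin m), ∀ t, join y t ∈ frontier U → normalHeight U (join y t) ≠ 0 := by
  have h1 : volume (horiz m '' (frontier U \ regularBoundary U)) = 0 := by
    have hl : LipschitzOnWith 1 (horiz m) (frontier U \ regularBoundary U) :=
      LipschitzOnWith.of_dist_le_mul fun q _ q' _ => by
        rw [dist_eq_norm, dist_eq_norm, ← map_sub, NNReal.coe_one, one_mul]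
        exact norm_horiz_le _
    have := hl.euclideanHausdorffMeasure_image_le m
    rw [EuclideanSpace.euclideanHausdorffMeasure_eq_volume, hU.measure_singular, mul_zero] at this
    exact le_antisymm this bot_le
  have h2 : volume (horiz m '' (regularFrontier U ∩ {x | normalHeight U x = 0})) = 0 := by
    have hm : MeasurableSet (regularFrontier U ∩ {x | normalHeight U x = 0}) :=
      (measurableSet_regularFrontier U).inter
        (measurable_normalHeight U (measurableSet_singleton 0))
    refine le_antisymm ((volume_horiz_image_le hU.measure_frontier_lt_top inter_subset_left
      hm).trans ?_) bot_le
    rw [setLIntegral_congr_fun hm (g := fun _ => 0) fun x hx => by simp [show _ = _ from hx.2]]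
    simp
  filter_upwards [measure_eq_zero_iff_ae_notMem.1 h1, measure_eq_zero_iff_ae_notMem.1 h2]
    with y hy1 hy2 t ht h0
  by_cases hr : join y t ∈ regularBoundary U
  · exact hy2 ⟨_, ⟨⟨ht, hr⟩, h0⟩, horiz_join y t⟩
  · exact hy1 ⟨_, ⟨ht, hr⟩, horiz_join y t⟩

theorem finite_setOf_join_mem_frontier {m : ℕ} {U : Set (Space m)} (hU : Bornology.IsBounded U)
    {y : EuclideanSpace ℝ (Fin m)}
    (hy : ∀ t, join y t ∈ frontier U → normalHeight U (join y t) ≠ 0) :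
    {t : ℝ | join y t ∈ frontier U}.Finite := by
  have hcomp : IsCompact {t : ℝ | join y t ∈ frontier U} := by
    refine Metric.isCompact_of_isClosed_isBounded
      (isClosed_frontier.preimage (continuous_join y)) ?_
    obtain ⟨R, hR⟩ := (hU.closure).exists_norm_le
    refine isBounded_iff_forall_norm_le.2 ⟨R, fun t ht => ?_⟩
    refine le_trans ?_ (hR _ (frontier_subset_closure ht))
    have := PiLp.norm_apply_le (join y t) (Fin.last m)
    rwa [join_last] at this
  have hloc : ∀ t ∈ {t : ℝ | join y t ∈ frontier U}, ∃ N ∈ 𝓝 t,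
      ∀ s ∈ N, join y s ∈ frontier U → s = t := fun t ht => by
    obtain ⟨N, hN, hinj⟩ := exists_nhds_injOn_horiz (hy t ht)
    refine ⟨_, (continuous_join y).continuousAt hN, fun s hs hsf => ?_⟩
    have := hinj ⟨hsf, hs⟩ ⟨ht, mem_of_mem_nhds hN⟩ (by simp)
    rw [← join_last y s, this, join_last]
  choose! N hN h using hloc
  obtain ⟨F, hF, hcov⟩ := hcomp.elim_nhds_subcover N hN
  refine F.finite_toSet.subset fun s hs => ?_
  obtain ⟨t, htF, hst⟩ := mem_iUnion₂.1 (hcov hs)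
  rw [h t (hF t htF) s hst hs]
  exact htF

theorem integrableOn_mul_normalHeight {m : ℕ} {U : Set (Space m)}
    (hU : (μHE[m] : Measure (Space m)) (frontier U) < ⊤) {Γ : Set (Space m)}
    (hΓ : Γ ⊆ frontier U) (hΓm : MeasurableSet Γ) {h : Space m → ℝ} (hh : Measurable h) {C : ℝ}
    (hC : ∀ x ∈ Γ, |h x| ≤ C) : IntegrableOn (fun x => h x * normalHeight U x) Γ μHE[m] := by
  refine Measure.integrableOn_of_bounded (M := C) ((measure_mono hΓ).trans_lt hU).ne
    (hh.mul (measurable_normalHeight U)).aestronglyMeasurable ?_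
  refine (ae_restrict_iff' hΓm).2 (ae_of_all _ fun x hx => ?_)
  rw [Real.norm_eq_abs, abs_mul]
  calc |h x| * |normalHeight U x| ≤ |h x| * 1 := by gcongr; exact abs_normalHeight_le U x
    _ ≤ C := by rw [mul_one]; exact hC x hx

/-- The flux of a vertical field `h e_d` through a part `Γ` of the boundary is the integral, over
all vertical lines, of the values of `h` at the points of `Γ` on the line, counted with sign. -/
theorem setIntegral_mul_normalHeight {m : ℕ} {U : Set (Space m)} (hU : IsPiecewiseC1Domain U)
    {Γ : Set (Space m)} (hΓ : Γ ⊆ frontier U) (hΓm : MeasurableSet Γ) {h : Space m → ℝ}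
    (hh : Measurable h) {C : ℝ} (hC : ∀ x ∈ Γ, |h x| ≤ C) :
    ∫ x in Γ, h x * normalHeight U x ∂μHE[m]
      = ∫ y, ∑' t : ℝ, Γ.indicator (fun x => h x * SignType.sign (normalHeight U x)) (join y t) := by
  set k : Space m → ℝ := fun x => h x * SignType.sign (normalHeight U x) with hk
  have hkm : Measurable k := by
    refine hh.mul ?_
    have hs : (fun x => ((SignType.sign (normalHeight U x) : SignType) : ℝ))
        = fun x => if 0 < normalHeight U x then 1 else if normalHeight U x < 0 then -1 else 0 := by
      ext x
      rw [sign_apply]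
      split_ifs <;> simp
    rw [hs]
    exact Measurable.ite (measurable_normalHeight U measurableSet_Ioi) measurable_const
      (Measurable.ite (measurable_normalHeight U measurableSet_Iio) measurable_const
        measurable_const)
  set Γ' : Set (Space m) := Γ ∩ {x | normalHeight U x ≠ 0} with hΓ'
  have hΓ'm : MeasurableSet Γ' :=
    hΓm.inter (measurable_normalHeight U (measurableSet_singleton 0)).compl
  have hint := integrableOn_mul_normalHeight hU.measure_frontier_lt_top hΓ hΓm hh hC
  have hint' := hint.mono_set (show Γ' ⊆ Γ from inter_subset_left)
  have hkn : ∀ x, h x * normalHeight U x = k x * |normalHeight U x| := fun x => by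
    simp only [hk]
    rw [mul_assoc, sign_mul_abs]
  have hrest : ∫ x in Γ, h x * normalHeight U x ∂μHE[m]
      = ∫ x in Γ', h x * normalHeight U x ∂μHE[m] := by
    refine setIntegral_eq_of_subset_of_forall_sdiff_eq_zero hΓm inter_subset_left ?_
    intro x hx
    have : normalHeight U x = 0 := by
      by_contra h0
      exact hx.2 ⟨hx.1, h0⟩
    rw [this, mul_zero]
  rw [hrest, integral_eq_lintegral_pos_part_sub_lintegral_neg_part hint']
  have hpart : ∀ g : Space m → ℝ, (∀ x, g x = h x * normalHeight U x ∨
      g x = - (h x * normalHeight U x)) → ∫⁻ x in Γ', ENNReal.ofReal (g x) ∂μHE[m] ≠ ⊤ := by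
    intro g hg
    have : ∫⁻ x in Γ', ENNReal.ofReal (g x) ∂μHE[m]
        ≤ ∫⁻ x in Γ', ‖h x * normalHeight U x‖ₑ ∂μHE[m] := by
      refine lintegral_mono fun x => ?_
      rw [← ofReal_norm, Real.norm_eq_abs]
      refine ENNReal.ofReal_le_ofReal ?_
      rcases hg x with h | h <;> rw [h]
      · exact le_abs_self _
      · exact neg_le_abs _
    exact (this.trans_lt hint'.hasFiniteIntegral).ne
  have hp := hpart (fun x => h x * normalHeight U x) fun x => Or.inl rfl
  have hn := hpart (fun x => -(h x * normalHeight U x)) fun x => Or.inr rfl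
  have hofm : ∀ x, ENNReal.ofReal (h x * normalHeight U x)
      = ENNReal.ofReal (k x) * ENNReal.ofReal |normalHeight U x| := fun x => by
    rw [hkn, ENNReal.ofReal_mul' (abs_nonneg _)]
  have hofm' : ∀ x, ENNReal.ofReal (-(h x * normalHeight U x))
      = ENNReal.ofReal (-k x) * ENNReal.ofReal |normalHeight U x| := fun x => by
    rw [hkn, ← neg_mul, ENNReal.ofReal_mul' (abs_nonneg _)]
  have hU' := hU.measure_frontier_lt_top
  obtain ⟨hm1, he1⟩ := lintegral_mul_normalHeight hU' (Γ := Γ') (fun x hx => hx.2) hΓ'm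
    (ENNReal.measurable_ofReal.comp hkm)
  obtain ⟨hm2, he2⟩ := lintegral_mul_normalHeight hU' (Γ := Γ') (fun x hx => hx.2) hΓ'm
    (ENNReal.measurable_ofReal.comp hkm.neg)
  simp only [Function.comp_def, Pi.neg_apply] at hm1 he1 hm2 he2
  simp only [hofm, hofm'] at hp hn ⊢
  rw [he1] at hp ⊢
  rw [he2] at hn ⊢
  rw [← integral_toReal hm1.aemeasurable (ae_lt_top hm1 hp),
    ← integral_toReal hm2.aemeasurable (ae_lt_top hm2 hn),
    ← integral_sub (integrable_toReal_of_lintegral_ne_top hm1.aemeasurable hp)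
      (integrable_toReal_of_lintegral_ne_top hm2.aemeasurable hn)]
  refine integral_congr_ae ?_
  filter_upwards [ae_normalHeight_ne_zero hU] with y hy
  have hF := finite_setOf_join_mem_frontier hU.isBounded hy
  have hout : ∀ t ∉ hF.toFinset, join y t ∉ Γ := fun t ht hmem =>
    ht (hF.mem_toFinset.2 (hΓ hmem))
  rw [tsum_eq_sum (s := hF.toFinset) fun t ht =>
      indicator_of_notMem (fun hmem => hout t ht hmem.1) _,
    tsum_eq_sum (s := hF.toFinset) fun t ht =>
      indicator_of_notMem (fun hmem => hout t ht hmem.1) _,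
    tsum_eq_sum (s := hF.toFinset) fun t ht => indicator_of_notMem (hout t ht) _,
    ENNReal.toReal_sum, ENNReal.toReal_sum, ← Finset.sum_sub_distrib]
  · refine Finset.sum_congr rfl fun t ht => ?_
    by_cases hmem : join y t ∈ Γ
    · have hmem' : join y t ∈ Γ' := ⟨hmem, hy t (hΓ hmem)⟩
      rw [indicator_of_mem hmem, indicator_of_mem hmem', indicator_of_mem hmem',
        ENNReal.toReal_ofReal', ENNReal.toReal_ofReal', max_zero_sub_eq_self]
    · rw [indicator_of_notMem hmem, indicator_of_notMem fun h => hmem h.1,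
        indicator_of_notMem fun h => hmem h.1]
      simp
  all_goals
    intro t _
    by_cases hmem : join y t ∈ Γ'
    · rw [indicator_of_mem hmem]
      exact ENNReal.ofReal_ne_top
    · rw [indicator_of_notMem hmem]
      exact ENNReal.zero_ne_top

/-! ### The divergence theorem for vertical fields -/

/-- The fundamental theorem of calculus on a bounded open subset `V` of the line with finitely many
boundary points, each with `V` on one side: `s t = 1` if `V` lies to the left of `t` and `s t = -1`
if it lies to the right. -/
theorem setIntegral_deriv_eq_sum_of_one_sided {V : Set ℝ} (hVo : IsOpen V)
    (hVb : Bornology.IsBounded V) {F : Finset ℝ} {s : ℝ → ℝ}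
    (hF : ∀ t ∉ F, (∀ᶠ x in 𝓝 t, x ∈ V) ∨ ∀ᶠ x in 𝓝 t, x ∉ V)
    (hs : ∀ t ∈ F, (s t = 1 ∧ ∀ᶠ x in 𝓝 t, x ∈ V ↔ x < t) ∨
      (s t = -1 ∧ ∀ᶠ x in 𝓝 t, x ∈ V ↔ t < x))
    {f f' : ℝ → ℝ} (hf : ∀ t, HasDerivAt f (f' t) t) (hf' : Continuous f') :
    ∫ t in V, f' t = ∑ t ∈ F, f t * s t := by
  classical
  -- `l t` and `r t` are the values of the indicator function of `V` to the left and right of `t`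
  have hlr : ∀ t : ℝ, ∃ l r : ℝ, (∀ᶠ x in 𝓝 t, (x < t → V.indicator 1 x = l) ∧
      (t < x → V.indicator 1 x = r)) ∧ (if t ∈ F then s t else 0) = l - r := by
    intro t
    by_cases ht : t ∈ F
    · rcases hs t ht with ⟨h1, h2⟩ | ⟨h1, h2⟩
      · refine ⟨1, 0, ?_, by simp [ht, h1]⟩
        filter_upwards [h2] with x hx
        exact ⟨fun h => indicator_of_mem (hx.2 h) _,
          fun h => indicator_of_notMem (fun hV => absurd (hx.1 hV) h.not_gt) _⟩
      · refine ⟨0, 1, ?_, by simp [ht, h1]⟩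
        filter_upwards [h2] with x hx
        exact ⟨fun h => indicator_of_notMem (fun hV => absurd (hx.1 hV) h.not_gt) _,
          fun h => indicator_of_mem (hx.2 h) _⟩
    · rcases hF t ht with h | h
      · refine ⟨1, 1, ?_, by simp [ht]⟩
        filter_upwards [h] with x hx
        exact ⟨fun _ => indicator_of_mem hx _, fun _ => indicator_of_mem hx _⟩
      · refine ⟨0, 0, ?_, by simp [ht]⟩
        filter_upwards [h] with x hx
        exact ⟨fun _ => indicator_of_notMem hx _, fun _ => indicator_of_notMem hx _⟩
  choose l r hlr hjump using hlr
  obtain ⟨R, hR⟩ := (hVb.union F.finite_toSet.isBounded).exists_norm_le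
  set g : ℝ → ℝ := V.indicator f' with hg
  have hgi : Integrable g := by
    rw [hg, integrable_indicator_iff hVo.measurableSet]
    exact (hf'.integrableOn_Icc (a := -R) (b := R)).mono_set fun x hx =>
      abs_le.1 (hR x (Or.inl hx))
  have hg1 : ∀ x, g x = V.indicator 1 x * f' x := fun x => by
    by_cases hx : x ∈ V <;> simp [hg, hx]
  have hI : ∀ a b c : ℝ, a ≤ b → (∀ x ∈ Ioo a b, V.indicator 1 x = c) →
      (∫ x in Iic b, g x) - ∫ x in Iic a, g x = c * (f b - f a) := by
    intro a b c hab hc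
    rw [intervalIntegral.integral_Iic_sub_Iic hgi.integrableOn hgi.integrableOn,
      ← intervalIntegral.integral_eq_sub_of_hasDerivAt (fun x _ => hf x)
        (hf'.intervalIntegrable a b), ← intervalIntegral.integral_const_mul]
    refine intervalIntegral.integral_congr_ae ?_
    filter_upwards [Measure.ae_ne volume b] with x hxb hx
    rw [uIoc_of_le hab] at hx
    rw [hg1, hc x ⟨hx.1, lt_of_le_of_ne hx.2 hxb⟩]
  -- the defect of the formula on the part of `V` to the left of `t` is locally constant
  set D : ℝ → ℝ := fun t => r t * f t - (∫ x in Iic t, g x)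
    + ∑ τ ∈ F, if τ ≤ t then f τ * s τ else 0 with hD
  have hloc : IsLocallyConstant D := by
    rw [IsLocallyConstant.iff_eventually_eq]
    intro t
    have hsum : ∀ᶠ x in 𝓝 t, ∀ τ ∈ F, τ ≠ t → (τ ≤ x ↔ τ ≤ t) := by
      rw [Filter.eventually_all_finset]
      intro τ _
      rcases lt_trichotomy τ t with h | h | h
      · filter_upwards [lt_mem_nhds h] with x hx _ using iff_of_true hx.le h.le
      · exact Filter.Eventually.of_forall fun x hx => absurd h hx
      · filter_upwards [gt_mem_nhds h] with x hx _ using iff_of_false hx.not_ge h.not_ge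
    obtain ⟨ε, hε, hball⟩ := Metric.eventually_nhds_iff_ball.1 (hlr t)
    have hr : ∀ x ∈ Metric.ball t ε, (x < t → r x = l t) ∧ (t < x → r x = r t) := by
      intro x hx
      have h1 : ∀ᶠ z in 𝓝[>] x, V.indicator 1 z = r x := by
        filter_upwards [nhdsWithin_le_nhds (hlr x), self_mem_nhdsWithin] with z hz hz' using hz.2 hz'
      have h2 : ∀ᶠ z in 𝓝[>] x, z ∈ Metric.ball t ε :=
        nhdsWithin_le_nhds (Metric.isOpen_ball.mem_nhds hx)
      constructor
      · intro hxt
        obtain ⟨z, hz1, hz2, hz3⟩ :=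
          (h1.and (h2.and (nhdsWithin_le_nhds (gt_mem_nhds hxt)))).exists
        rw [← hz1, (hball z hz2).1 hz3]
      · intro hxt
        obtain ⟨z, hz1, hz2, hz3⟩ :=
          (h1.and (h2.and (nhdsWithin_le_nhds (lt_mem_nhds hxt)))).exists
        rw [← hz1, (hball z hz2).2 hz3]
    filter_upwards [hsum, Metric.ball_mem_nhds t hε] with x hx hxb
    rcases lt_trichotomy x t with h | h | h
    · have hint := hI x t (l t) h.le fun z hz => by
        refine (hball z ?_).1 hz.2
        rw [Metric.mem_ball, Real.dist_eq, abs_lt] at hxb ⊢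
        constructor <;> linarith [hz.1, hz.2]
      have hsum : (∑ τ ∈ F, if τ ≤ t then f τ * s τ else 0)
          - (∑ τ ∈ F, if τ ≤ x then f τ * s τ else 0) = f t * (l t - r t) := by
        rw [← hjump t, ← Finset.sum_sub_distrib]
        have h0 : ∀ τ ∈ F, ((if τ ≤ t then f τ * s τ else 0) - if τ ≤ x then f τ * s τ else 0)
            = if t = τ then f τ * s τ else 0 := by
          intro τ hτ
          by_cases hτt : τ = t
          · subst hτt
            simp [h.not_ge]
          · rw [if_neg (Ne.symm hτt)]
            simp [hx τ hτ hτt]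
        rw [Finset.sum_congr rfl h0, Finset.sum_ite_eq, mul_ite, mul_zero]
      simp only [hD]
      rw [(hr x hxb).1 h]
      linarith
    · rw [h]
    · have hint := hI t x (r t) h.le fun z hz => by
        refine (hball z ?_).2 hz.1
        rw [Metric.mem_ball, Real.dist_eq, abs_lt] at hxb ⊢
        constructor <;> linarith [hz.1, hz.2]
      have hsum : (∑ τ ∈ F, if τ ≤ t then f τ * s τ else 0)
          = ∑ τ ∈ F, if τ ≤ x then f τ * s τ else 0 := by
        refine Finset.sum_congr rfl fun τ hτ => ?_
        by_cases hτt : τ = t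
        · subst hτt
          simp [h.le]
        · simp [hx τ hτ hτt]
      simp only [hD]
      rw [(hr x hxb).2 h]
      linarith
  have hr0 : ∀ t, R < |t| → r t = 0 := by
    intro t ht
    have h1 : ∀ᶠ z in 𝓝[>] t, R < |z| :=
      nhdsWithin_le_nhds (continuous_abs.continuousAt.eventually_const_lt ht)
    obtain ⟨z, hz1, hz2, hz3⟩ := (h1.and ((Filter.Eventually.filter_mono nhdsWithin_le_nhds
      (hlr t)).and self_mem_nhdsWithin)).exists
    rw [← hz2.2 hz3]
    exact indicator_of_notMem (fun hz => absurd (hR z (Or.inl hz)) (not_le.2 hz1)) _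
  rcases V.eq_empty_or_nonempty with hV | ⟨z, hz⟩
  · -- an empty set has no one-sided boundary point
    have hFe : F = ∅ := by
      refine Finset.eq_empty_of_forall_notMem fun t ht => ?_
      rcases hs t ht with ⟨-, h⟩ | ⟨-, h⟩
      · obtain ⟨x, hx, hx'⟩ := ((Filter.Eventually.filter_mono nhdsWithin_le_nhds h).and
          (self_mem_nhdsWithin (s := Iio t))).exists
        exact absurd (hx.2 hx') (by simp [hV])
      · obtain ⟨x, hx, hx'⟩ := ((Filter.Eventually.filter_mono nhdsWithin_le_nhds h).and
          (self_mem_nhdsWithin (s := Ioi t))).exists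
        exact absurd (hx.2 hx') (by simp [hV])
    simp [hV, hFe]
  have hR0 : 0 ≤ R := (norm_nonneg z).trans (hR z (Or.inl hz))
  -- the defect vanishes far to the left, and is that of the claim far to the right
  have hend := hloc.apply_eq_of_preconnectedSpace (R + 1) (-(R + 1))
  simp only [hD] at hend
  rw [hr0 (R + 1) (by rw [abs_of_pos (by linarith)]; linarith),
    hr0 (-(R + 1)) (by rw [abs_neg, abs_of_pos (by linarith)]; linarith)] at hend
  have hFR : ∀ τ ∈ F, -R ≤ τ ∧ τ ≤ R := fun τ hτ => abs_le.1 (hR τ (Or.inr hτ))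
  have h1 : ∫ x in Iic (-(R + 1)), g x = 0 := by
    refine setIntegral_eq_zero_of_forall_eq_zero fun x hx => indicator_of_notMem (fun hxV => ?_) _
    have := (abs_le.1 (hR x (Or.inl hxV))).1
    have := mem_Iic.1 hx
    linarith
  have h2 : ∫ x in Iic (R + 1), g x = ∫ x in V, f' x := by
    rw [hg, setIntegral_indicator hVo.measurableSet, inter_eq_self_of_subset_right]
    intro x hx
    have := (abs_le.1 (hR x (Or.inl hx))).2
    rw [mem_Iic]
    linarith
  have h3 : (∑ τ ∈ F, if τ ≤ R + 1 then f τ * s τ else 0) = ∑ τ ∈ F, f τ * s τ :=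
    Finset.sum_congr rfl fun τ hτ => if_pos (by linarith [hFR τ hτ])
  have h4 : (∑ τ ∈ F, if τ ≤ -(R + 1) then f τ * s τ else 0) = 0 :=
    Finset.sum_eq_zero fun τ hτ => if_neg (by linarith [hFR τ hτ])
  rw [h1, h2, h3, h4] at hend
  linarith

theorem eventually_neg_iff_lt_of_hasDerivAt {g : ℝ → ℝ} {g' t : ℝ} (hg : HasDerivAt g g' t)
    (hg' : 0 < g') (h0 : g t = 0) : ∀ᶠ x in 𝓝 t, g x < 0 ↔ x < t := by
  have h := (hasDerivAt_iff_tendsto_slope.1 hg).eventually_const_lt hg'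
  filter_upwards [eventually_nhdsWithin_iff.1 h] with x hx
  rcases lt_trichotomy x t with hxt | hxt | hxt
  · have := hx hxt.ne
    rw [slope_def_field, h0, sub_zero] at this
    exact iff_of_true (by
      by_contra hcon
      exact absurd this (not_lt.2 (div_nonpos_of_nonneg_of_nonpos (not_lt.1 hcon)
        (by linarith)))) hxt
  · simp [hxt, h0]
  · have := hx hxt.ne'
    rw [slope_def_field, h0, sub_zero] at this
    refine iff_of_false (fun hcon => ?_) hxt.not_gt
    exact absurd this (not_lt.2 (div_nonpos_of_nonpos_of_nonneg hcon.le (by linarith)))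

/-- On a vertical line crossing the boundary transversally, the set lies on the side of the boundary
point given by the sign of the vertical component of the normal. -/
theorem sign_normalHeight_one_sided {m : ℕ} {U : Set (Space m)} {y : EuclideanSpace ℝ (Fin m)}
    {t : ℝ} (h : normalHeight U (join y t) ≠ 0) :
    ((SignType.sign (normalHeight U (join y t)) : ℝ) = 1 ∧
      ∀ᶠ x in 𝓝 t, join y x ∈ U ↔ x < t) ∨
    ((SignType.sign (normalHeight U (join y t)) : ℝ) = -1 ∧
      ∀ᶠ x in 𝓝 t, join y x ∈ U ↔ t < x) := by
  have hr : join y t ∈ regularFrontier U := mem_of_indicator_ne_zero h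
  obtain ⟨φ, hφ, h0, hg, hU, hν⟩ := isOutwardUnitNormal_outwardNormal hr.2
  rw [normalHeight_of_mem hr, hν] at h ⊢
  have hd : HasDerivAt (fun x => φ (join y x)) (gradient φ (join y t) (Fin.last m)) t := by
    have h1 := ((hφ.differentiableAt (by norm_num)).hasFDerivAt).comp_hasDerivAt t
      (hasDerivAt_join y t)
    have h2 : fderiv ℝ φ (join y t) (EuclideanSpace.single (Fin.last m) 1)
        = gradient φ (join y t) (Fin.last m) := by
      rw [← one_mul (gradient φ (join y t) (Fin.last m)), ← inner_single_last]
      simp [gradient]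
    rwa [h2] at h1
  have hUt : ∀ᶠ x in 𝓝 t, join y x ∈ U ↔ φ (join y x) < 0 :=
    (continuous_join y).continuousAt.eventually hU
  have hpos : 0 < ‖gradient φ (join y t)‖⁻¹ := inv_pos.2 (norm_pos_iff.2 hg)
  rw [PiLp.smul_apply, smul_eq_mul] at h ⊢
  rcases lt_or_gt_of_ne (right_ne_zero_of_mul h) with hneg | hgt
  · right
    refine ⟨by rw [sign_neg (mul_neg_of_pos_of_neg hpos hneg)]; simp, ?_⟩
    -- reflect the line to reduce to a positive derivative
    have h3 : HasDerivAt (fun x => φ (join y (-x))) (-gradient φ (join y t) (Fin.last m)) (-t) := by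
      have h4 : HasDerivAt (fun x => φ (join y x)) (gradient φ (join y t) (Fin.last m)) (-(-t)) := by
        rwa [neg_neg]
      simpa [Function.comp_def] using h4.scomp (-t) (hasDerivAt_neg (-t))
    have h5 := eventually_neg_iff_lt_of_hasDerivAt h3 (neg_pos.2 hneg) (by rw [neg_neg, h0])
    have h6 := (continuous_neg (G := ℝ)).continuousAt.eventually h5
    filter_upwards [hUt, h6] with x hx hx'
    rw [neg_neg, neg_lt_neg_iff] at hx'
    rw [hx, hx']
  · left
    refine ⟨by rw [sign_pos (mul_pos hpos hgt)]; simp, ?_⟩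
    filter_upwards [hUt, eventually_neg_iff_lt_of_hasDerivAt hd hgt h0] with x hx hx'
    rw [hx, hx']

theorem measurePreserving_join (m : ℕ) :
    MeasurePreserving (fun p : EuclideanSpace ℝ (Fin m) × ℝ => (join p.1 p.2 : Space m))
      (volume.prod volume) volume := by
  have h1 : MeasurePreserving (fun p : EuclideanSpace ℝ (Fin m) × ℝ => (p.2, WithLp.ofLp p.1))
      (volume.prod volume) (volume.prod volume) :=
    ((MeasurePreserving.id volume).prod (PiLp.volume_preserving_ofLp (Fin m))).comp
      Measure.measurePreserving_swap
  have h2 := ((volume_preserving_piFinSuccAbove (fun _ : Fin (m + 1) => ℝ) (Fin.last m)).symm).comp h1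
  have h3 := (PiLp.volume_preserving_toLp (Fin (m + 1))).comp h2
  convert! h3 using 1
  ext p i
  induction i using Fin.lastCases <;>
    simp [MeasurableEquiv.piFinSuccAbove, Fin.insertNthEquiv, Fin.insertNth_last']

theorem measurableEmbedding_join (m : ℕ) :
    MeasurableEmbedding (fun p : EuclideanSpace ℝ (Fin m) × ℝ => (join p.1 p.2 : Space m)) := by
  refine (measurePreserving_join m).measurable.measurableEmbedding fun p q hpq => ?_
  replace hpq : (join p.1 p.2 : Space m) = join q.1 q.2 := hpq
  refine Prod.ext ?_ ?_
  · rw [← horiz_join p.1 p.2, hpq, horiz_join]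
  · rw [← join_last p.1 p.2, hpq, join_last]

/-- The divergence theorem for a vertical field `f e_d`: integrate along vertical lines, almost all
of which cross the boundary transversally at finitely many regular points. -/
theorem setIntegral_fderiv_vertical {m : ℕ} {U : Set (Space m)} (hU : IsPiecewiseC1Domain U)
    {f : Space m → ℝ} (hf : ContDiff ℝ 1 f) :
    ∫ x in U, fderiv ℝ f x (EuclideanSpace.single (Fin.last m) 1)
      = ∫ x in frontier U, f x * normalHeight U x ∂μHE[m] := by
  have hcl : IsCompact (closure U) :=
    Metric.isCompact_of_isClosed_isBounded isClosed_closure hU.isBounded.closure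
  obtain ⟨C, hC⟩ := hcl.exists_bound_of_continuousOn hf.continuous.continuousOn
  rw [setIntegral_mul_normalHeight hU subset_rfl isClosed_frontier.measurableSet
    hf.continuous.measurable (C := C) fun x hx => hC x (frontier_subset_closure hx)]
  set f' : Space m → ℝ := fun x => fderiv ℝ f x (EuclideanSpace.single (Fin.last m) 1) with hf'
  have hf'c : Continuous f' := (hf.continuous_fderiv (by norm_num)).clm_apply continuous_const
  have hi : Integrable (U.indicator f') := by
    rw [integrable_indicator_iff hU.isOpen.measurableSet]
    exact (hf'c.continuousOn.integrableOn_compact hcl).mono_set subset_closure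
  rw [← integral_indicator hU.isOpen.measurableSet,
    ← (measurePreserving_join m).integral_comp (measurableEmbedding_join m), integral_prod]
  swap
  · exact (measurePreserving_join m).integrable_comp_of_integrable hi
  refine integral_congr_ae ?_
  filter_upwards [ae_normalHeight_ne_zero hU] with y hy
  have hF := finite_setOf_join_mem_frontier hU.isBounded hy
  have hVo : IsOpen (join y ⁻¹' U) := hU.isOpen.preimage (continuous_join y)
  have hVb : Bornology.IsBounded (join y ⁻¹' U) := by
    obtain ⟨R, hR⟩ := hU.isBounded.exists_norm_le
    refine isBounded_iff_forall_norm_le.2 ⟨R, fun t ht => le_trans ?_ (hR _ ht)⟩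
    have := PiLp.norm_apply_le (join y t) (Fin.last m)
    rwa [join_last] at this
  have hd : ∀ t, HasDerivAt (fun t => f (join y t)) (f' (join y t)) t := fun t =>
    ((hf.differentiable (by norm_num)) (join y t)).hasFDerivAt.comp_hasDerivAt t
      (hasDerivAt_join y t)
  have h1 := setIntegral_deriv_eq_sum_of_one_sided hVo hVb (F := hF.toFinset)
    (s := fun t => SignType.sign (normalHeight U (join y t))) ?_ ?_ hd
    (hf'c.comp (continuous_join y))
  · have hout : ∀ t ∉ hF.toFinset, (frontier U).indicator
        (fun x => f x * SignType.sign (normalHeight U x)) (join y t) = 0 := fun t ht =>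
      indicator_of_notMem (s := frontier U) (fun hmem => ht (hF.mem_toFinset.2 hmem)) _
    rw [tsum_eq_sum hout]
    have h2 : ∀ t, U.indicator f' (join y t)
        = (join y ⁻¹' U).indicator (fun t => f' (join y t)) t := fun t => rfl
    change ∫ t, U.indicator f' (join y t) = _
    simp only [h2]
    rw [integral_indicator hVo.measurableSet, h1]
    refine Finset.sum_congr rfl fun t ht => ?_
    rw [indicator_of_mem (show join y t ∈ frontier U from hF.mem_toFinset.1 ht)]
  · intro t ht
    have ht' : join y t ∉ frontier U := fun h => ht (hF.mem_toFinset.2 h)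
    by_cases hin : join y t ∈ U
    · exact Or.inl (hVo.mem_nhds hin)
    · right
      have hncl : join y t ∉ closure U := fun h =>
        ht' ⟨h, by rwa [hU.isOpen.interior_eq]⟩
      filter_upwards [(continuous_join y).continuousAt
        (isClosed_closure.isOpen_compl.mem_nhds hncl)] with x hx hxU
      exact hx (subset_closure hxU)
  · intro t ht
    exact sign_normalHeight_one_sided (hy t (hF.mem_toFinset.1 ht))

/-! ### Motion of a domain by a `C¹` map -/

/-- `B` is a `C¹` map of the whole space which is injective, with positive Jacobian determinant, on
the closure of `U`. -/
structure IsRegularMotion {m : ℕ} (B : Space m → Space m) (U : Set (Space m)) : Prop where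
  contDiff : ContDiff ℝ 1 B
  injOn : InjOn B (closure U)
  det_pos : ∀ x ∈ closure U, 0 < (fderiv ℝ B x).det

namespace IsRegularMotion

variable {m : ℕ} {B : Space m → Space m} {U : Set (Space m)}

theorem exists_hasStrictFDerivAt (hB : IsRegularMotion B U) {x : Space m} (hx : x ∈ closure U) :
    ∃ e : Space m ≃L[ℝ] Space m, (e : Space m →L[ℝ] Space m) = fderiv ℝ B x ∧
      HasStrictFDerivAt B (e : Space m →L[ℝ] Space m) x := by
  refine ⟨(fderiv ℝ B x).toContinuousLinearEquivOfDetNeZero (hB.det_pos x hx).ne', by simp, ?_⟩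
  rw [ContinuousLinearMap.coe_toContinuousLinearEquivOfDetNeZero]
  exact hB.contDiff.hasStrictFDerivAt (by norm_num)

theorem isOpen_image (hB : IsRegularMotion B U) (hU : IsOpen U) : IsOpen (B '' U) := by
  rw [isOpen_iff_mem_nhds]
  rintro _ ⟨x, hx, rfl⟩
  obtain ⟨e, -, he⟩ := hB.exists_hasStrictFDerivAt (subset_closure hx)
  rw [← he.map_nhds_eq_of_equiv]
  exact Filter.image_mem_map (hU.mem_nhds hx)

theorem closure_image (hB : IsRegularMotion B U) (hb : Bornology.IsBounded U) :
    closure (B '' U) = B '' closure U :=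
  (image_closure_of_isCompact (Metric.isCompact_of_isClosed_isBounded isClosed_closure hb.closure)
    hB.contDiff.continuous.continuousOn).symm

theorem frontier_image (hB : IsRegularMotion B U) (hU : IsOpen U) (hb : Bornology.IsBounded U) :
    frontier (B '' U) = B '' frontier U := by
  rw [(hB.isOpen_image hU).frontier_eq, hU.frontier_eq, hB.closure_image hb,
    hB.injOn.image_sdiff_subset subset_closure]

/-- A point of the closure of `U` whose image is close to `B p` is close to `p`. -/
theorem eventually_mem_of_map_mem (hB : IsRegularMotion B U) (hb : Bornology.IsBounded U)
    {p : Space m} (hp : p ∈ closure U) {N : Set (Space m)} (hN : N ∈ 𝓝 p) :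
    ∀ᶠ x in 𝓝 (B p), ∀ u ∈ closure U, B u = x → u ∈ N := by
  have hK : IsCompact (closure U \ interior N) :=
    (Metric.isCompact_of_isClosed_isBounded isClosed_closure hb.closure).diff isOpen_interior
  have hnot : B p ∉ B '' (closure U \ interior N) := by
    rintro ⟨q, hq, hqp⟩
    rw [hB.injOn hq.1 hp hqp] at hq
    exact hq.2 (mem_interior_iff_mem_nhds.2 hN)
  filter_upwards [(hK.image hB.contDiff.continuous).isClosed.isOpen_compl.mem_nhds hnot]
    with x hx u hu hux
  by_contra hcon
  exact hx ⟨u, ⟨hu, fun h => hcon (interior_subset h)⟩, hux⟩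

/-- Regular boundary points are mapped to regular boundary points, and the normal is transported by
the inverse transpose of the derivative. -/
theorem exists_isOutwardUnitNormal_image (hB : IsRegularMotion B U) (hb : Bornology.IsBounded U)
    {p ν : Space m} (hp : p ∈ closure U) (h : IsOutwardUnitNormal U p ν) :
    ∃ ν', IsOutwardUnitNormal (B '' U) (B p) ν' ∧
      ∃ c : ℝ, 0 < c ∧ ∀ v, inner ℝ ν' (fderiv ℝ B p v) = c * inner ℝ ν v := by
  obtain ⟨φ, hφ, h0, hg, hU, rfl⟩ := h
  obtain ⟨e, hed, he⟩ := hB.exists_hasStrictFDerivAt hp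
  set G := hB.contDiff.contDiffAt.localInverse he.hasFDerivAt one_ne_zero with hG
  have hGp : G (B p) = p :=
    hB.contDiff.contDiffAt.localInverse_apply_image he.hasFDerivAt one_ne_zero
  have hGc : ContDiffAt ℝ 1 G (B p) :=
    hB.contDiff.contDiffAt.to_localInverse he.hasFDerivAt one_ne_zero
  have hGe : HasFDerivAt G (e.symm : Space m →L[ℝ] Space m) (B p) := he.to_localInverse.hasFDerivAt
  have hl : ∀ᶠ u in 𝓝 p, G (B u) = u := he.eventually_left_inverse
  have hr : ∀ᶠ x in 𝓝 (B p), B (G x) = x := he.eventually_right_inverse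
  have hGt : Filter.Tendsto G (𝓝 (B p)) (𝓝 p) := by
    have := hGc.continuousAt.tendsto
    rwa [hGp] at this
  have hφG : ContDiffAt ℝ 1 (φ ∘ G) (B p) := by
    refine ContDiffAt.comp _ ?_ hGc
    rwa [hGp]
  have hd : ∀ v, inner ℝ (gradient (φ ∘ G) (B p)) (fderiv ℝ B p v)
      = inner ℝ (gradient φ p) v := fun v => by
    have h1 : HasFDerivAt (φ ∘ G) ((fderiv ℝ φ p).comp (e.symm : Space m →L[ℝ] Space m)) (B p) := by
      refine HasFDerivAt.comp _ ?_ hGe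
      rw [hGp]
      exact (hφ.differentiableAt (by norm_num)).hasFDerivAt
    have h2 : ∀ (ψ : Space m → ℝ) (x u : Space m), inner ℝ (gradient ψ x) u = fderiv ℝ ψ x u :=
      fun ψ x u => by simp [gradient]
    rw [h2, h2, h1.fderiv, ← hed]
    simp
  have hg' : gradient (φ ∘ G) (B p) ≠ 0 := by
    intro hzero
    have := hd (gradient φ p)
    rw [hzero, inner_zero_left] at this
    exact hg (inner_self_eq_zero.1 this.symm)
  refine ⟨_, ⟨φ ∘ G, hφG, by simp [hGp, h0], hg', ?_, rfl⟩,
    ‖gradient (φ ∘ G) (B p)‖⁻¹ * ‖gradient φ p‖,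
    mul_pos (inv_pos.2 (norm_pos_iff.2 hg')) (norm_pos_iff.2 hg), fun v => ?_⟩
  · filter_upwards [hr, hGt.eventually hU, hB.eventually_mem_of_map_mem hb hp hl]
      with x hx1 hx2 hx3
    rw [Function.comp_apply, ← hx2]
    constructor
    · rintro ⟨u, hu, rfl⟩
      have h3 : G (B u) = u := hx3 u (subset_closure hu) rfl
      rwa [h3]
    · intro h
      exact ⟨_, h, hx1⟩
  · rw [real_inner_smul_left, real_inner_smul_left, hd, mul_assoc,
      mul_inv_cancel_left₀ (norm_ne_zero_iff.2 hg)]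

theorem isPiecewiseC1Domain_image (hB : IsRegularMotion B U) (hU : IsPiecewiseC1Domain U) :
    IsPiecewiseC1Domain (B '' U) := by
  have hcomp : IsCompact (closure U) :=
    Metric.isCompact_of_isClosed_isBounded isClosed_closure hU.isBounded.closure
  obtain ⟨K, hK⟩ := LocallyLipschitzOn.exists_lipschitzOnWith_of_compact hcomp
    (hB.contDiff.locallyLipschitz.locallyLipschitzOn (s := closure U))
  have hf := hB.frontier_image hU.isOpen hU.isBounded
  refine ⟨hB.isOpen_image hU.isOpen, ?_, ?_, ?_⟩
  · exact (hcomp.image hB.contDiff.continuous).isBounded.subset (image_mono subset_closure)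
  · rw [hf]
    refine ((hK.mono frontier_subset_closure).euclideanHausdorffMeasure_image_le m).trans_lt ?_
    exact ENNReal.mul_lt_top (ENNReal.pow_lt_top ENNReal.coe_lt_top) hU.measure_frontier_lt_top
  · have hsub : frontier (B '' U) \ regularBoundary (B '' U)
        ⊆ B '' (frontier U \ regularBoundary U) := by
      rw [hf]
      rintro _ ⟨⟨p, hp, rfl⟩, hnr⟩
      refine ⟨p, ⟨hp, fun ⟨ν, hν⟩ => hnr ?_⟩, rfl⟩
      obtain ⟨ν', hν', -⟩ := hB.exists_isOutwardUnitNormal_image hU.isBounded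
        (frontier_subset_closure hp) hν
      exact ⟨ν', hν'⟩
    have h := (hK.mono (sdiff_subset.trans frontier_subset_closure :
      frontier U \ regularBoundary U ⊆ closure U)).euclideanHausdorffMeasure_image_le m
    rw [hU.measure_singular, mul_zero] at h
    exact le_antisymm ((measure_mono hsub).trans h) bot_le

theorem sign_normalHeight_image (hB : IsRegularMotion B U) (hU : IsPiecewiseC1Domain U)
    {p : Space m} (hp : p ∈ regularFrontier U) {c : ℝ} (hc : 0 < c)
    (hBe : fderiv ℝ B p (EuclideanSpace.single (Fin.last m) 1)
      = EuclideanSpace.single (Fin.last m) c) :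
    SignType.sign (normalHeight (B '' U) (B p)) = SignType.sign (normalHeight U p) := by
  obtain ⟨ν', hν', a, ha, hν⟩ := hB.exists_isOutwardUnitNormal_image hU.isBounded
    (frontier_subset_closure hp.1) (isOutwardUnitNormal_outwardNormal hp.2)
  have hmem : B p ∈ regularFrontier (B '' U) := by
    refine ⟨?_, ν', hν'⟩
    rw [hB.frontier_image hU.isOpen hU.isBounded]
    exact mem_image_of_mem _ hp.1
  have h := hν (EuclideanSpace.single (Fin.last m) 1)
  rw [hBe, inner_single_last, inner_single_last, one_mul] at h
  rw [normalHeight_of_mem hmem, normalHeight_of_mem hp, hν'.outwardNormal_eq]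
  have h1 := congrArg SignType.sign h
  rwa [sign_mul, sign_mul, sign_pos hc, sign_pos ha, one_mul, one_mul] at h1

/-- A motion along the vertical lines preserves the fluxes of vertical fields: both are integrals
over the vertical lines of the same signed sums. -/
theorem setIntegral_image_mul_normalHeight (hB : IsRegularMotion B U) (hU : IsPiecewiseC1Domain U)
    (hhoriz : ∀ x ∈ closure U, horiz m (B x) = horiz m x)
    (hBe : ∀ x ∈ closure U, ∃ c : ℝ, 0 < c ∧
      fderiv ℝ B x (EuclideanSpace.single (Fin.last m) 1) = EuclideanSpace.single (Fin.last m) c)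
    {Γ : Set (Space m)} (hΓ : Γ ⊆ frontier U) (hΓc : IsClosed Γ) {F : Space m → ℝ}
    (hF : Measurable F) {C : ℝ} (hC : ∀ x ∈ Γ, |F (B x)| ≤ C) :
    ∫ x in B '' Γ, F x * normalHeight (B '' U) x ∂μHE[m]
      = ∫ x in Γ, F (B x) * normalHeight U x ∂μHE[m] := by
  have hΓK : IsCompact Γ := Metric.isCompact_of_isClosed_isBounded hΓc
    (hU.isBounded.closure.subset (hΓ.trans frontier_subset_closure))
  have hcl : ∀ x ∈ Γ, x ∈ closure U := fun x hx => frontier_subset_closure (hΓ hx)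
  rw [setIntegral_mul_normalHeight (hB.isPiecewiseC1Domain_image hU) (Γ := B '' Γ) ?_
      (hΓK.image hB.contDiff.continuous).isClosed.measurableSet hF (C := C) ?_,
    setIntegral_mul_normalHeight hU hΓ hΓc.measurableSet (h := fun x => F (B x))
      (hF.comp hB.contDiff.continuous.measurable) hC]
  rotate_left
  · rw [hB.frontier_image hU.isOpen hU.isBounded]
    exact image_mono hΓ
  · rintro _ ⟨x, hx, rfl⟩
    exact hC x hx
  refine integral_congr_ae ?_
  filter_upwards [ae_normalHeight_ne_zero hU] with y hy
  have hsign : ∀ x ∈ Γ, horiz m x = y →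
      SignType.sign (normalHeight (B '' U) (B x)) = SignType.sign (normalHeight U x) := by
    intro x hx hxy
    obtain ⟨c, hc, hcx⟩ := hBe x (hcl x hx)
    refine hB.sign_normalHeight_image hU (mem_of_indicator_ne_zero (?_ : normalHeight U x ≠ 0))
      hc hcx
    rw [← join_horiz x, hxy]
    refine hy _ ?_
    rw [← hxy, join_horiz]
    exact hΓ hx
  have hjoin : ∀ t, join y t ∈ Γ → join y (B (join y t) (Fin.last m)) = B (join y t) := by
    intro t ht
    conv_rhs => rw [← join_horiz (B (join y t)), hhoriz _ (hcl _ ht), horiz_join]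
  have hmem : ∀ t : Function.support fun t => Γ.indicator
      (fun x => F (B x) * SignType.sign (normalHeight U x)) (join y t), join y t ∈ Γ :=
    fun t => by
      by_contra h
      exact t.2 (indicator_of_notMem h _)
  refine tsum_eq_tsum_of_ne_zero_bij (fun t => B (join y t) (Fin.last m)) ?_ ?_ ?_
  · intro s t hst
    have h1 : B (join y s) = B (join y t) := by
      rw [← hjoin s (hmem s), ← hjoin t (hmem t)]
      exact congrArg _ hst
    have h2 := hB.injOn (hcl _ (hmem s)) (hcl _ (hmem t)) h1
    refine Subtype.ext ?_
    rw [← join_last y s, h2, join_last]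
  · intro t ht
    have htm : join y t ∈ B '' Γ := by
      by_contra h
      exact ht (indicator_of_notMem h _)
    obtain ⟨x, hx, hxt⟩ := htm
    have hxy : horiz m x = y := by rw [← hhoriz x (hcl x hx), hxt, horiz_join]
    have hxj : join y (x (Fin.last m)) = x := by rw [← hxy, join_horiz]
    refine ⟨⟨x (Fin.last m), ?_⟩, ?_⟩
    · rw [Function.mem_support] at ht ⊢
      rw [hxj, indicator_of_mem hx, ← hsign x hx hxy]
      rwa [← hxt, indicator_of_mem (mem_image_of_mem B hx)] at ht
    · simp only [hxj, hxt, join_last]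
  · intro t
    have h := hmem t
    rw [hjoin t h, indicator_of_mem (mem_image_of_mem B h), indicator_of_mem h,
      hsign _ h (horiz_join y t)]

end IsRegularMotion

/-! ### Vertical motions and the potential energy -/

theorem contDiff_meshMap {m : ℕ} (δt : ℝ) {W : Space m → Space m} (hW : ContDiff ℝ 1 W) :
    ContDiff ℝ 1 (meshMap δt W) :=
  contDiff_id.add (hW.const_smul δt)

theorem contDiff_apply_last {m : ℕ} {W : Space m → Space m} (hW : ContDiff ℝ 1 W) :
    ContDiff ℝ 1 fun x => W x (Fin.last m) :=
  (EuclideanSpace.proj (𝕜 := ℝ) (Fin.last m)).contDiff.comp hW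

/-- The derivative of a vertical motion is a transvection along the vertical axis; this persists on
the boundary by continuity. -/
theorem fderiv_meshMap_vertical {m : ℕ} {U : Set (Space m)} (hU : IsOpen U) {W : Space m → Space m}
    (hW : ContDiff ℝ 1 W) (hvert : ∀ x ∈ U, W x = EuclideanSpace.single (Fin.last m)
      (W x (Fin.last m))) (δt : ℝ) {x : Space m} (hx : x ∈ closure U) (u : Space m) :
    fderiv ℝ (meshMap δt W) x u
      = u + (δt * fderiv ℝ (fun x => W x (Fin.last m)) x u) •
        EuclideanSpace.single (Fin.last m) (1 : ℝ) := by
  set ω : Space m → ℝ := fun x => W x (Fin.last m) with hω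
  have hωc : ContDiff ℝ 1 ω := contDiff_apply_last hW
  have hcl : IsClosed {x | fderiv ℝ (meshMap δt W) x u
      = u + (δt * fderiv ℝ ω x u) • EuclideanSpace.single (Fin.last m) (1 : ℝ)} := by
    refine isClosed_eq ?_ ?_
    · exact ((contDiff_meshMap δt hW).continuous_fderiv (by norm_num)).clm_apply continuous_const
    · exact continuous_const.add ((continuous_const.mul ((hωc.continuous_fderiv
        (by norm_num)).clm_apply continuous_const)).smul continuous_const)
  refine closure_minimal (fun z hz => ?_) hcl hx
  have heq : meshMap δt W =ᶠ[𝓝 z]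
      fun x => x + (δt * ω x) • EuclideanSpace.single (Fin.last m) (1 : ℝ) := by
    filter_upwards [hU.mem_nhds hz] with x hx
    have h1 : W x = ω x • EuclideanSpace.single (Fin.last m) (1 : ℝ) := by
      rw [hvert x hx]
      ext i
      simp [hω]
    rw [meshMap, h1, smul_smul]
  have hd : HasFDerivAt ω (fderiv ℝ ω z) z :=
    (hωc.differentiable (by norm_num) z).hasFDerivAt
  have := ((hasFDerivAt_id z).add ((hd.const_mul δt).smul_const
    (EuclideanSpace.single (Fin.last m) (1 : ℝ)))).congr_of_eventuallyEq heq
  rw [mem_ofPred_eq, this.fderiv]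
  simp

theorem det_fderiv_meshMap_vertical {m : ℕ} {U : Set (Space m)} (hU : IsOpen U)
    {W : Space m → Space m} (hW : ContDiff ℝ 1 W)
    (hvert : ∀ x ∈ U, W x = EuclideanSpace.single (Fin.last m) (W x (Fin.last m))) (δt : ℝ)
    {x : Space m} (hx : x ∈ closure U) :
    (fderiv ℝ (meshMap δt W) x).det = 1 + δt * fderiv ℝ (fun x => W x (Fin.last m)) x
      (EuclideanSpace.single (Fin.last m) 1) := by
  have h : ((fderiv ℝ (meshMap δt W) x : Space m →L[ℝ] Space m) : Space m →ₗ[ℝ] Space m)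
      = LinearMap.transvection
        ((δt • fderiv ℝ (fun x => W x (Fin.last m)) x : Space m →L[ℝ] ℝ) : Space m →ₗ[ℝ] ℝ)
        (EuclideanSpace.single (Fin.last m) 1) := by
    ext1 u
    simpa [LinearMap.transvection] using fderiv_meshMap_vertical hU hW hvert δt hx u
  rw [ContinuousLinearMap.det, h, LinearMap.transvection.det]
  simp

/-- The first moment of height gained by a domain moved vertically by `δt ω` is the flux through its
boundary of the vertical field of height `((x_d + δt ω)² - x_d²) / 2`. -/
theorem setIntegral_height_image {m : ℕ} {U : Set (Space m)} (hU : IsPiecewiseC1Domain U)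
    {W : Space m → Space m} {δt : ℝ} (hB : IsRegularMotion (meshMap δt W) U)
    (hW : ContDiff ℝ 1 W)
    (hvert : ∀ x ∈ U, W x = EuclideanSpace.single (Fin.last m) (W x (Fin.last m))) :
    ∫ x in meshMap δt W '' U, x (Fin.last m) = (∫ x in U, x (Fin.last m))
      + ∫ x in frontier U, (δt * (x (Fin.last m) * W x (Fin.last m))
        + δt ^ 2 / 2 * W x (Fin.last m) ^ 2) * normalHeight U x ∂μHE[m] := by
  set ω : Space m → ℝ := fun x => W x (Fin.last m) with hω
  have hωc : ContDiff ℝ 1 ω := contDiff_apply_last hW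
  have hzc : ContDiff ℝ 1 fun x : Space m => x (Fin.last m) := contDiff_apply_last contDiff_id
  set f : Space m → ℝ := fun x => δt * (x (Fin.last m) * ω x) + δt ^ 2 / 2 * ω x ^ 2 with hf
  have hfc : ContDiff ℝ 1 f :=
    (contDiff_const.mul (hzc.mul hωc)).add (contDiff_const.mul (hωc.pow 2))
  change _ = _ + ∫ x in frontier U, f x * normalHeight U x ∂μHE[m]
  have hcl : IsCompact (closure U) :=
    Metric.isCompact_of_isClosed_isBounded isClosed_closure hU.isBounded.closure
  have hint : ∀ {k : Space m → ℝ}, Continuous k → IntegrableOn k U := fun hk =>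
    (hk.continuousOn.integrableOn_compact hcl).mono_set subset_closure
  rw [← setIntegral_fderiv_vertical hU hfc,
    integral_image_eq_integral_abs_det_fderiv_smul volume hU.isOpen.measurableSet
      (fun x _ => (hB.contDiff.differentiable (by norm_num) x).hasFDerivAt.hasFDerivWithinAt)
      (hB.injOn.mono subset_closure), ← integral_add (hint hzc.continuous)
      (hint ((hfc.continuous_fderiv (by norm_num)).clm_apply continuous_const))]
  refine setIntegral_congr_fun hU.isOpen.measurableSet fun x hx => ?_
  have hpos := hB.det_pos x (subset_closure hx)
  have hd : HasFDerivAt ω (fderiv ℝ ω x) x :=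
    (hωc.differentiable (by norm_num) x).hasFDerivAt
  have hz : HasFDerivAt (fun x : Space m => x (Fin.last m))
      (EuclideanSpace.proj (𝕜 := ℝ) (Fin.last m)) x :=
    (EuclideanSpace.proj (𝕜 := ℝ) (Fin.last m) : Space m →L[ℝ] ℝ).hasFDerivAt
  have hfd := (((hz.mul hd).const_mul δt).add ((hd.pow 2).const_mul (δt ^ 2 / 2))).fderiv
  have hfd' : fderiv ℝ f x (EuclideanSpace.single (Fin.last m) 1)
      = δt * (x (Fin.last m) * fderiv ℝ ω x (EuclideanSpace.single (Fin.last m) 1) + ω x)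
        + δt ^ 2 / 2 * (2 * ω x * fderiv ℝ ω x (EuclideanSpace.single (Fin.last m) 1)) := by
    have := congrArg (fun L : Space m →L[ℝ] ℝ => L (EuclideanSpace.single (Fin.last m) 1)) hfd
    refine Eq.trans this ?_
    simp
    ring
  have hval : meshMap δt W x (Fin.last m) = x (Fin.last m) + δt * ω x := by
    simp [meshMap, hω]
  simp only
  rw [abs_of_pos hpos, det_fderiv_meshMap_vertical hU.isOpen hW hvert δt (subset_closure hx),
    hfd', hval, smul_eq_mul]
  ring

/-- On each subdomain the mesh map coincides with a `C¹` map of the whole space that is a regular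
vertical motion. -/
theorem IsSmoothMotionOn.exists_vertical_extension {m : ℕ} {Ω U : Set (Space m)} (hUΩ : U ⊆ Ω)
    {δt : ℝ} {v : Space m → Space m} (hv : IsSmoothMotionOn U δt v)
    (hinj : InjOn (meshMap δt v) (closure Ω)) {w : Space m → ℝ}
    (hw : ∀ y ∈ closure Ω, v y = EuclideanSpace.single (Fin.last m) (w y)) :
    ∃ W : Space m → Space m, ContDiff ℝ 1 W ∧ IsRegularMotion (meshMap δt W) U ∧
      EqOn (meshMap δt v) (meshMap δt W) (closure U) ∧
      ∀ x ∈ closure U, W x = EuclideanSpace.single (Fin.last m) (w x) := by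
  obtain ⟨W, hW, hvW, hdet⟩ := hv
  have hA : EqOn (meshMap δt v) (meshMap δt W) (closure U) := fun x hx => by
    simp only [meshMap, hvW hx]
  have hcl : closure U ⊆ closure Ω := closure_mono hUΩ
  exact ⟨W, hW, ⟨contDiff_meshMap δt hW, (hinj.mono hcl).congr hA, hdet⟩, hA,
    fun x hx => by rw [← hvW hx, hw x (hcl hx)]⟩

theorem density_mul_mul_eq {m : ℕ} (ρ₁ ρ₂ g : ℝ) (Ω₁ Ω₂ : Set (Space m)) (x : Space m) :
    density ρ₁ ρ₂ Ω₁ Ω₂ x * g * x (Fin.last m)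
      = Ω₁.indicator (fun x => ρ₁ * g * x (Fin.last m)) x
        + Ω₂.indicator (fun x => ρ₂ * g * x (Fin.last m)) x := by
  by_cases h1 : x ∈ Ω₁ <;> by_cases h2 : x ∈ Ω₂ <;> simp [density, h1, h2, add_mul]

theorem integrableOn_indicator_height {m : ℕ} {s U : Set (Space m)} (hs : Bornology.IsBounded s)
    (hU : MeasurableSet U) (c : ℝ) :
    IntegrableOn (U.indicator fun x : Space m => c * x (Fin.last m)) s := by
  have hcl : IsCompact (closure s) :=
    Metric.isCompact_of_isClosed_isBounded isClosed_closure hs.closure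
  have hc : Continuous fun x : Space m => c * x (Fin.last m) :=
    continuous_const.mul (contDiff_apply_last (m := m) contDiff_id).continuous
  exact ((hc.continuousOn.integrableOn_compact hcl).mono_set subset_closure).indicator hU

theorem integrableOn_density_mul {m : ℕ} (ρ₁ ρ₂ g : ℝ) {Ω Ω₁ Ω₂ : Set (Space m)}
    (hΩ : Bornology.IsBounded Ω) (h₁ : MeasurableSet Ω₁) (h₂ : MeasurableSet Ω₂) :
    IntegrableOn (fun x => density ρ₁ ρ₂ Ω₁ Ω₂ x * g * x (Fin.last m)) Ω := by
  simp only [density_mul_mul_eq]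
  exact (integrableOn_indicator_height hΩ h₁ _).add (integrableOn_indicator_height hΩ h₂ _)

theorem potentialEnergy_eq {m : ℕ} (g ρ₁ ρ₂ : ℝ) {Ω Ω₁ Ω₂ : Set (Space m)}
    (hΩ : Bornology.IsBounded Ω) (h₁ : MeasurableSet Ω₁) (h₂ : MeasurableSet Ω₂)
    (hs₁ : Ω₁ ⊆ Ω) (hs₂ : Ω₂ ⊆ Ω) :
    potentialEnergy g ρ₁ ρ₂ Ω Ω₁ Ω₂ = ρ₁ * g * (∫ x in Ω₁, x (Fin.last m))
      + ρ₂ * g * ∫ x in Ω₂, x (Fin.last m) := by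
  unfold potentialEnergy
  simp only [density_mul_mul_eq]
  rw [integral_add (integrableOn_indicator_height hΩ h₁ _) (integrableOn_indicator_height hΩ h₂ _),
    setIntegral_indicator h₁, setIntegral_indicator h₂, inter_eq_self_of_subset_right hs₁,
    inter_eq_self_of_subset_right hs₂, integral_const_mul, integral_const_mul]

/-! ### Normals on the interface and on the wall -/

theorem eventually_sub_smul_mem_iff {m : ℕ} {U : Set (Space m)} {p ν v : Space m}
    (h : IsOutwardUnitNormal U p ν) (hv : inner ℝ ν v < 0) :
    ∀ᶠ t : ℝ in 𝓝 0, p - t • v ∈ U ↔ t < 0 := by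
  obtain ⟨φ, hφ, h0, hg, hU, rfl⟩ := h
  have hpos : 0 < ‖gradient φ p‖⁻¹ := inv_pos.2 (norm_pos_iff.2 hg)
  have hl : HasDerivAt (fun t : ℝ => p - t • v) (-v) 0 := by
    simpa using ((hasDerivAt_id (0 : ℝ)).smul_const v).const_sub p
  have hd : HasDerivAt (fun t : ℝ => φ (p - t • v)) (fderiv ℝ φ p (-v)) 0 := by
    refine HasFDerivAt.comp_hasDerivAt (f := fun t : ℝ => p - t • v) 0 ?_ hl
    simpa using (hφ.differentiableAt (by norm_num)).hasFDerivAt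
  have h1 : 0 < fderiv ℝ φ p (-v) := by
    have : fderiv ℝ φ p (-v) = -inner ℝ (gradient φ p) v := by simp [gradient]
    rw [this, neg_pos]
    rw [real_inner_smul_left] at hv
    exact (pos_iff_neg_of_mul_neg hv).1 hpos
  have hUt : ∀ᶠ t : ℝ in 𝓝 0, p - t • v ∈ U ↔ φ (p - t • v) < 0 := by
    have := hl.continuousAt
    rw [ContinuousAt, zero_smul, sub_zero] at this
    exact this.eventually hU
  filter_upwards [hUt, eventually_neg_iff_lt_of_hasDerivAt hd h1 (by simp [h0])] with t h2 h3
  rw [h2, h3]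

/-- Disjoint sets have opposite normals at common regular boundary points. -/
theorem IsOutwardUnitNormal.eq_neg_of_disjoint {m : ℕ} {U V : Set (Space m)} {p ν μ : Space m}
    (hU : IsOutwardUnitNormal U p ν) (hV : IsOutwardUnitNormal V p μ) (hd : Disjoint U V) :
    μ = -ν := by
  by_contra hne
  have hlt : -1 < inner ℝ μ ν := by
    refine lt_of_le_of_ne ?_ fun h => hne
      ((inner_eq_neg_one_iff_of_norm_eq_one hV.norm_eq_one hU.norm_eq_one).1 h.symm)
    have := neg_le_of_abs_le (abs_real_inner_le_norm μ ν)
    rwa [hU.norm_eq_one, hV.norm_eq_one, one_mul] at this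
  -- the direction `-(ν + μ)` would point into both sets
  have h1 : inner ℝ ν (-(ν + μ)) < 0 := by
    rw [inner_neg_right, inner_add_right, real_inner_self_eq_norm_sq, hU.norm_eq_one,
      real_inner_comm]
    linarith
  have h2 : inner ℝ μ (-(ν + μ)) < 0 := by
    rw [inner_neg_right, inner_add_right, real_inner_self_eq_norm_sq, hV.norm_eq_one]
    linarith
  obtain ⟨t, ht, ht0⟩ := ((Filter.Eventually.filter_mono nhdsWithin_le_nhds
    ((eventually_sub_smul_mem_iff hU h1).and (eventually_sub_smul_mem_iff hV h2))).and
    (self_mem_nhdsWithin (s := Iio (0 : ℝ)))).exists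
  exact disjoint_left.1 hd (ht.1.2 ht0) (ht.2.2 ht0)

/-- There are no regular boundary points inside the closure: a function defining the boundary there
would have a local maximum with nonzero gradient. -/
theorem closure_notMem_nhds_of_mem_regularFrontier {m : ℕ} {U : Set (Space m)} {p : Space m}
    (hp : p ∈ regularFrontier U) : closure U ∉ 𝓝 p := by
  intro hcl
  obtain ⟨_, φ, hφ, h0, hg, hU, -⟩ := hp.2
  have hmax : IsLocalMax φ p := by
    filter_upwards [hcl, hU, eventually_frontier_imp_eq_zero hφ hU] with x hx hxU hxf
    rw [h0]
    by_cases h : x ∈ U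
    · exact (hxU.1 h).le
    · exact (hxf ⟨hx, fun hi => h (interior_subset hi)⟩).le
  exact hg (by simp [gradient, hmax.fderiv_eq_zero])

theorem IsTwoFluidDomain.symm {m : ℕ} {Ω Ω₁ Ω₂ : Set (Space m)} (h : IsTwoFluidDomain Ω Ω₁ Ω₂) :
    IsTwoFluidDomain Ω Ω₂ Ω₁ :=
  ⟨h.domain, h.domain₂, h.domain₁, h.subset₂, h.subset₁, h.disjoint.symm, by
    rw [h.closure_eq, union_comm]⟩

/-- Away from the interface, a regular boundary point of a subdomain is a regular point of the wall,
with the same normal. -/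
theorem IsTwoFluidDomain.isOutwardUnitNormal_wall {m : ℕ} {Ω Ω₁ Ω₂ : Set (Space m)}
    (h : IsTwoFluidDomain Ω Ω₁ Ω₂) {p ν : Space m} (hp : p ∈ frontier Ω₁) (hp₂ : p ∉ frontier Ω₂)
    (hν : IsOutwardUnitNormal Ω₁ p ν) : IsOutwardUnitNormal Ω p ν := by
  have hncl : p ∉ closure Ω₂ := by
    intro hcl
    have hin : p ∈ Ω₂ := by
      by_contra hnot
      exact hp₂ ⟨hcl, by rwa [h.domain₂.isOpen.interior_eq]⟩
    obtain ⟨x, hx₂, hx₁⟩ := mem_closure_iff.1 hp.1 Ω₂ h.domain₂.isOpen hin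
    exact disjoint_left.1 h.disjoint hx₁ hx₂
  obtain ⟨ν', -, hreg⟩ := eventually_isOutwardUnitNormal ⟨ν, hν⟩
  have hev : ∀ᶠ x in 𝓝 p, x ∈ Ω ↔ x ∈ Ω₁ := by
    have hloc : ∀ᶠ x in 𝓝 p, x ∉ closure Ω₂ := isClosed_closure.isOpen_compl.mem_nhds hncl
    filter_upwards [eventually_eventually_nhds.2 hloc, hreg] with x hx hxr
    refine ⟨fun hxΩ => ?_, fun hx₁ => h.subset₁ hx₁⟩
    have hnear : closure Ω₁ ∈ 𝓝 x := by
      filter_upwards [hx, h.domain.isOpen.mem_nhds hxΩ] with z hz hzΩ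
      have := subset_closure hzΩ
      rw [h.closure_eq] at this
      exact this.resolve_right hz
    by_contra hnot
    have hxf : x ∈ frontier Ω₁ :=
      ⟨mem_of_mem_nhds hnear, by rwa [h.domain₁.isOpen.interior_eq]⟩
    exact closure_notMem_nhds_of_mem_regularFrontier ⟨hxf, _, hxr hxf⟩ hnear
  obtain ⟨φ, hφ, h0, hg, hU, rfl⟩ := hν
  refine ⟨φ, hφ, h0, hg, ?_, rfl⟩
  filter_upwards [hev, hU] with x hx hxU
  rw [hx, hxU]

/-- A vertical velocity tangent to the wall has no flux through the part of the boundary of a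
subdomain which lies off the interface. -/
theorem IsTwoFluidDomain.mul_normalHeight_eq_zero {m : ℕ} {Ω Ω₁ Ω₂ : Set (Space m)}
    (h : IsTwoFluidDomain Ω Ω₁ Ω₂) {v : Space m → Space m} {w : Space m → ℝ}
    (htan : ∀ p ∈ regularBoundary Ω, inner ℝ (v p) (outwardNormal Ω p) = 0)
    (hw : ∀ y ∈ closure Ω, v y = EuclideanSpace.single (Fin.last m) (w y)) {p : Space m}
    (hp : p ∈ frontier Ω₁) (hp₂ : p ∉ frontier Ω₂) : w p * normalHeight Ω₁ p = 0 := by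
  by_cases hr : p ∈ regularBoundary Ω₁
  · have hn := isOutwardUnitNormal_outwardNormal hr
    have hn' := h.isOutwardUnitNormal_wall hp hp₂ hn
    have ht := htan p ⟨_, hn'⟩
    rw [hn'.outwardNormal_eq, hw p (closure_mono h.subset₁ (frontier_subset_closure hp)),
      real_inner_comm, inner_single_last] at ht
    rwa [normalHeight_of_mem ⟨hp, hr⟩]
  · rw [normalHeight, indicator_of_notMem fun hmem => hr hmem.2, mul_zero]

theorem ae_mem_regularBoundary {m : ℕ} {U : Set (Space m)} (hU : IsPiecewiseC1Domain U)
    {Γ : Set (Space m)} (hΓ : Γ ⊆ frontier U) (hΓm : MeasurableSet Γ) :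
    ∀ᵐ x ∂(μHE[m] : Measure (Space m)).restrict Γ, x ∈ regularFrontier U := by
  rw [ae_restrict_iff' hΓm]
  filter_upwards [measure_eq_zero_iff_ae_notMem.1 hU.measure_singular] with x hx hxΓ
  refine ⟨hΓ hxΓ, ?_⟩
  by_contra hnot
  exact hx ⟨hΓ hxΓ, hnot⟩

theorem measurableSet_interface {m : ℕ} (Ω₁ Ω₂ : Set (Space m)) :
    MeasurableSet (interface Ω₁ Ω₂) :=
  (isClosed_frontier.inter isClosed_frontier).measurableSet

theorem IsTwoFluidDomain.ae_normalHeight_eq_neg {m : ℕ} {Ω Ω₁ Ω₂ : Set (Space m)}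
    (h : IsTwoFluidDomain Ω Ω₁ Ω₂) :
    ∀ᵐ x ∂(μHE[m] : Measure (Space m)).restrict (interface Ω₁ Ω₂),
      normalHeight Ω₂ x = -normalHeight Ω₁ x := by
  filter_upwards [ae_mem_regularBoundary h.domain₁ inter_subset_left (measurableSet_interface _ _),
    ae_mem_regularBoundary h.domain₂ inter_subset_right (measurableSet_interface _ _)]
    with x hx₁ hx₂
  rw [normalHeight_of_mem hx₁, normalHeight_of_mem hx₂,
    (isOutwardUnitNormal_outwardNormal hx₁.2).eq_neg_of_disjoint
      (isOutwardUnitNormal_outwardNormal hx₂.2) h.disjoint]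
  rfl

/-- Surface integrals against the normal may be computed with `normalHeight` and with a measurable
function that agrees with the integrand on the surface. -/
theorem integrableOn_and_setIntegral_mul_outwardNormal {m : ℕ} {U : Set (Space m)}
    (hU : IsPiecewiseC1Domain U) {Γ : Set (Space m)} (hΓ : Γ ⊆ frontier U) (hΓm : MeasurableSet Γ)
    {F G : Space m → ℝ} (hF : Measurable F) {C : ℝ} (hC : ∀ x ∈ Γ, |F x| ≤ C)
    (hFG : ∀ x ∈ Γ, G x = F x) :
    IntegrableOn (fun x => G x * outwardNormal U x (Fin.last m)) Γ μHE[m] ∧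
      ∫ x in Γ, G x * outwardNormal U x (Fin.last m) ∂μHE[m]
        = ∫ x in Γ, F x * normalHeight U x ∂μHE[m] := by
  have hae : (fun x => G x * outwardNormal U x (Fin.last m))
      =ᵐ[(μHE[m] : Measure (Space m)).restrict Γ] fun x => F x * normalHeight U x := by
    filter_upwards [ae_mem_regularBoundary hU hΓ hΓm, ae_restrict_mem hΓm] with x hx hxΓ
    rw [hFG x hxΓ, normalHeight_of_mem hx]
  exact ⟨(integrableOn_mul_normalHeight hU.measure_frontier_lt_top hΓ hΓm hF hC).congr hae.symm,
    integral_congr_ae hae⟩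

/-! ### The two subdomains during a time step -/

theorem transported_apply {m : ℕ} {F : Type*} {δt : ℝ} {v : Space m → Space m} {Ω : Set (Space m)}
    (hinj : InjOn (meshMap δt v) (closure Ω)) (f : Space m → F) {x : Space m}
    (hx : x ∈ closure Ω) : transported δt v Ω f (meshMap δt v x) = f x := by
  rw [transported, hinj.leftInvOn_invFunOn hx]

/-- The first moment of height of a subdomain changes by a flux through the interface alone, since the
velocity is tangent to the wall. -/
theorem IsTwoFluidDomain.setIntegral_height_image {m : ℕ} {Ω Ω₁ Ω₂ : Set (Space m)}
    (h : IsTwoFluidDomain Ω Ω₁ Ω₂) {v : Space m → Space m} {w : Space m → ℝ}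
    (htan : ∀ p ∈ regularBoundary Ω, inner ℝ (v p) (outwardNormal Ω p) = 0)
    (hw : ∀ y ∈ closure Ω, v y = EuclideanSpace.single (Fin.last m) (w y))
    {W : Space m → Space m} {δt : ℝ} (hB : IsRegularMotion (meshMap δt W) Ω₁)
    (hW : ContDiff ℝ 1 W)
    (hWw : ∀ x ∈ closure Ω₁, W x = EuclideanSpace.single (Fin.last m) (w x)) :
    ∫ x in meshMap δt W '' Ω₁, x (Fin.last m) = (∫ x in Ω₁, x (Fin.last m))
      + ∫ x in interface Ω₁ Ω₂, (δt * (x (Fin.last m) * w x) + δt ^ 2 / 2 * w x ^ 2)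
        * normalHeight Ω₁ x ∂μHE[m] := by
  have hWl : ∀ x ∈ closure Ω₁, W x (Fin.last m) = w x := fun x hx => by simp [hWw x hx]
  rw [ALE.setIntegral_height_image h.domain₁ hB hW fun x hx => by
    rw [hWl x (subset_closure hx), hWw x (subset_closure hx)]]
  congr 1
  rw [setIntegral_congr_fun isClosed_frontier.measurableSet (g := fun x =>
    (δt * (x (Fin.last m) * w x) + δt ^ 2 / 2 * w x ^ 2) * normalHeight Ω₁ x) fun x hx => by
      simp only [hWl x (frontier_subset_closure hx)]]
  refine setIntegral_eq_of_subset_of_forall_sdiff_eq_zero isClosed_frontier.measurableSet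
    inter_subset_left fun x hx => ?_
  have h0 := h.mul_normalHeight_eq_zero htan hw hx.1 fun hx₂ => hx.2 ⟨hx.1, hx₂⟩
  linear_combination (δt * x (Fin.last m) + δt ^ 2 / 2 * w x) * h0

theorem IsTwoFluidDomain.isBounded_image {m : ℕ} {Ω Ω₁ Ω₂ : Set (Space m)}
    (h : IsTwoFluidDomain Ω Ω₁ Ω₂) {v : Space m → Space m} {w : Space m → ℝ} {δt : ℝ}
    (hv : IsMeshVelocity Ω Ω₁ Ω₂ δt v)
    (hw : ∀ y ∈ closure Ω, v y = EuclideanSpace.single (Fin.last m) (w y)) :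
    Bornology.IsBounded (meshMap δt v '' Ω) := by
  obtain ⟨W₁, -, hB₁, hA₁, -⟩ := hv.smooth₁.exists_vertical_extension h.subset₁ hv.injOn hw
  obtain ⟨W₂, -, hB₂, hA₂, -⟩ := hv.smooth₂.exists_vertical_extension h.subset₂ hv.injOn hw
  have hsub : meshMap δt v '' Ω ⊆ meshMap δt W₁ '' closure Ω₁ ∪ meshMap δt W₂ '' closure Ω₂ := by
    rw [← hA₁.image_eq, ← hA₂.image_eq, ← image_union, ← h.closure_eq]
    exact image_mono subset_closure
  refine Bornology.IsBounded.subset (Bornology.IsBounded.union ?_ ?_) hsub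
  · rw [← hB₁.closure_image h.domain₁.isBounded]
    exact (hB₁.isPiecewiseC1Domain_image h.domain₁).isBounded.closure
  · rw [← hB₂.closure_image h.domain₂.isBounded]
    exact (hB₂.isPiecewiseC1Domain_image h.domain₂).isBounded.closure

/-- The potential energy changes by `-δρ g` times a flux through the interface: the moments of the two
subdomains change by opposite amounts, because their normals are opposite there. -/
theorem IsTwoFluidDomain.potentialEnergy_image {m : ℕ} {Ω Ω₁ Ω₂ : Set (Space m)}
    (h : IsTwoFluidDomain Ω Ω₁ Ω₂) {v : Space m → Space m} {w : Space m → ℝ} {δt : ℝ}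
    (hv : IsMeshVelocity Ω Ω₁ Ω₂ δt v)
    (hw : ∀ y ∈ closure Ω, v y = EuclideanSpace.single (Fin.last m) (w y)) (g ρ₁ ρ₂ : ℝ) :
    potentialEnergy g ρ₁ ρ₂ (meshMap δt v '' Ω) (meshMap δt v '' Ω₁) (meshMap δt v '' Ω₂)
      = potentialEnergy g ρ₁ ρ₂ Ω Ω₁ Ω₂ - (ρ₂ - ρ₁) * g *
        ∫ x in interface Ω₁ Ω₂, (δt * (x (Fin.last m) * w x) + δt ^ 2 / 2 * w x ^ 2)
          * normalHeight Ω₁ x ∂μHE[m] := by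
  obtain ⟨W₁, hW₁, hB₁, hA₁, hWw₁⟩ := hv.smooth₁.exists_vertical_extension h.subset₁ hv.injOn hw
  obtain ⟨W₂, hW₂, hB₂, hA₂, hWw₂⟩ := hv.smooth₂.exists_vertical_extension h.subset₂ hv.injOn hw
  have hi₁ : meshMap δt v '' Ω₁ = meshMap δt W₁ '' Ω₁ :=
    (hA₁.mono subset_closure).image_eq
  have hi₂ : meshMap δt v '' Ω₂ = meshMap δt W₂ '' Ω₂ :=
    (hA₂.mono subset_closure).image_eq
  have hbd := h.isBounded_image hv hw
  have hneg : ∫ x in interface Ω₂ Ω₁, (δt * (x (Fin.last m) * w x) + δt ^ 2 / 2 * w x ^ 2)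
        * normalHeight Ω₂ x ∂μHE[m]
      = -∫ x in interface Ω₁ Ω₂, (δt * (x (Fin.last m) * w x) + δt ^ 2 / 2 * w x ^ 2)
        * normalHeight Ω₁ x ∂μHE[m] := by
    rw [show interface Ω₂ Ω₁ = interface Ω₁ Ω₂ from inter_comm _ _, ← integral_neg]
    refine integral_congr_ae ?_
    filter_upwards [h.ae_normalHeight_eq_neg] with x hx
    rw [hx, mul_neg]
  rw [potentialEnergy_eq g ρ₁ ρ₂ hbd (hi₁ ▸ hB₁.isOpen_image h.domain₁.isOpen).measurableSet
      (hi₂ ▸ hB₂.isOpen_image h.domain₂.isOpen).measurableSet (image_mono h.subset₁)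
      (image_mono h.subset₂),
    potentialEnergy_eq g ρ₁ ρ₂ h.domain.isBounded h.domain₁.isOpen.measurableSet
      h.domain₂.isOpen.measurableSet h.subset₁ h.subset₂, hi₁, hi₂,
    h.setIntegral_height_image hv.tangent hw hB₁ hW₁ hWw₁,
    h.symm.setIntegral_height_image hv.tangent hw hB₂ hW₂ hWw₂, hneg]
  ring

theorem IsTwoFluidDomain.interface_image {m : ℕ} {Ω Ω₁ Ω₂ : Set (Space m)}
    (h : IsTwoFluidDomain Ω Ω₁ Ω₂) {v : Space m → Space m} {w : Space m → ℝ} {δt : ℝ}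
    (hv : IsMeshVelocity Ω Ω₁ Ω₂ δt v)
    (hw : ∀ y ∈ closure Ω, v y = EuclideanSpace.single (Fin.last m) (w y)) :
    interface (meshMap δt v '' Ω₁) (meshMap δt v '' Ω₂)
      = meshMap δt v '' interface Ω₁ Ω₂ := by
  obtain ⟨W₁, -, hB₁, hA₁, -⟩ := hv.smooth₁.exists_vertical_extension h.subset₁ hv.injOn hw
  obtain ⟨W₂, -, hB₂, hA₂, -⟩ := hv.smooth₂.exists_vertical_extension h.subset₂ hv.injOn hw
  have h₁ : frontier Ω₁ ⊆ closure Ω₁ := frontier_subset_closure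
  have h₂ : frontier Ω₂ ⊆ closure Ω₂ := frontier_subset_closure
  rw [interface, interface, (hA₁.mono subset_closure).image_eq,
    (hA₂.mono subset_closure).image_eq, hB₁.frontier_image h.domain₁.isOpen h.domain₁.isBounded,
    hB₂.frontier_image h.domain₂.isOpen h.domain₂.isBounded, ← (hA₁.mono h₁).image_eq,
    ← (hA₂.mono h₂).image_eq, hv.injOn.image_inter (h₁.trans (closure_mono h.subset₁))
      (h₂.trans (closure_mono h.subset₂))]

end ALE

theorem mainTheorem4 (m : ℕ) (hm : m = 1 ∨ m = 2)
    (Ω Ω₁ Ω₂ : Set (Space m)) (hΩ : IsTwoFluidDomain Ω Ω₁ Ω₂)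
    (ρ₁ ρ₂ g δt : ℝ) (hδt : 0 < δt)
    (v : Space m → Space m) (hv : IsMeshVelocity Ω Ω₁ Ω₂ δt v)
    (w : Space m → ℝ)
    (hw : ∀ y ∈ closure Ω, v y = EuclideanSpace.single (Fin.last m) (w y)) :
    let δρ : ℝ := ρ₂ - ρ₁
    let A : Space m → Space m := meshMap δt v
    let S : Set (Space m) := interface Ω₁ Ω₂
    let S' : Set (Space m) := interface (A '' Ω₁) (A '' Ω₂)
    let n : Space m → Space m := outwardNormal Ω₁
    let n' : Space m → Space m := outwardNormal (A '' Ω₁)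
    let v' : Space m → Space m := transported δt v Ω v
    let w' : Space m → ℝ := transported δt v Ω w
    let P : ℝ := potentialEnergy g ρ₁ ρ₂ Ω Ω₁ Ω₂
    let P' : ℝ := potentialEnergy g ρ₁ ρ₂ (A '' Ω) (A '' Ω₁) (A '' Ω₂)
    let σ : Measure (Space m) := μHE[m]
    -- all the integrals below converge
    (IntegrableOn (fun x => density ρ₁ ρ₂ Ω₁ Ω₂ x * g * x (Fin.last m)) Ω ∧
      IntegrableOn (fun x => density ρ₁ ρ₂ (A '' Ω₁) (A '' Ω₂) x * g * x (Fin.last m)) (A '' Ω) ∧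
      IntegrableOn (fun x => g * x (Fin.last m) * δρ * w x * n x (Fin.last m)) S σ ∧
      IntegrableOn (fun x => g * x (Fin.last m) * δρ * w' x * n' x (Fin.last m)) S' σ ∧
      IntegrableOn (fun x => δρ * g * w x ^ 2 * n x (Fin.last m)) S σ) ∧
    -- the identities on the interface at the beginning of the time step
    (∫ x in S, g * x (Fin.last m) * δρ * inner ℝ (v x) (n x) ∂σ =
        ∫ x in S, g * x (Fin.last m) * δρ * w x * n x (Fin.last m) ∂σ ∧
      ∫ x in S, g * x (Fin.last m) * δρ * w x * n x (Fin.last m) ∂σ =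
        -(1 / δt) * (P' - P) -
          δt / 2 * ∫ x in S, δρ * g * w x ^ 2 * n x (Fin.last m) ∂σ) ∧
    -- the identities on the interface at the end of the time step
    (∫ x in S', g * x (Fin.last m) * δρ * inner ℝ (v' x) (n' x) ∂σ =
        ∫ x in S', g * x (Fin.last m) * δρ * w' x * n' x (Fin.last m) ∂σ ∧
      ∫ x in S', g * x (Fin.last m) * δρ * w' x * n' x (Fin.last m) ∂σ =
        -(1 / δt) * (P' - P) +
          δt / 2 * ∫ x in S, δρ * g * w x ^ 2 * n x (Fin.last m) ∂σ) := by
  intro δρ A S S' n n' v' w' P P' σ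
  obtain ⟨W, hW, hB, hAB, hWw⟩ := hv.smooth₁.exists_vertical_extension hΩ.subset₁ hv.injOn hw
  set B : Space m → Space m := meshMap δt W with hBdef
  set ω : Space m → ℝ := fun x => W x (Fin.last m) with hω
  have hωc : Continuous ω := (contDiff_apply_last hW).continuous
  have hzc : Continuous fun x : Space m => x (Fin.last m) :=
    (contDiff_apply_last (m := m) contDiff_id).continuous
  have hcl₁ : closure Ω₁ ⊆ closure Ω := closure_mono hΩ.subset₁
  have hωw : ∀ x ∈ closure Ω₁, ω x = w x := fun x hx => by simp [hω, hWw x hx]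
  have hSc : IsClosed S := isClosed_frontier.inter isClosed_frontier
  have hSf : S ⊆ frontier Ω₁ := inter_subset_left
  have hScl : ∀ x ∈ S, x ∈ closure Ω₁ := fun x hx => frontier_subset_closure (hSf hx)
  have hSK : IsCompact S := Metric.isCompact_of_isClosed_isBounded hSc
    (hΩ.domain₁.isBounded.closure.subset hScl)
  have hA₁ : A '' Ω₁ = B '' Ω₁ := (hAB.mono subset_closure).image_eq
  have hS'A : S' = A '' S := hΩ.interface_image hv hw
  have hS'B : S' = B '' S := hS'A.trans (hAB.mono hScl).image_eq
  have hS'm : MeasurableSet S' := measurableSet_interface _ _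
  have hdom' : IsPiecewiseC1Domain (A '' Ω₁) := hA₁ ▸ hB.isPiecewiseC1Domain_image hΩ.domain₁
  have hS'f : S' ⊆ frontier (A '' Ω₁) := inter_subset_left
  have hBl : ∀ x, B x (Fin.last m) = x (Fin.last m) + δt * ω x := fun x => by
    simp [hBdef, meshMap, hω]
  -- `w` is arbitrary off `closure Ω`; here is a measurable function equal to the transported
  -- velocity on the new interface
  have hemb : MeasurableEmbedding fun x : closure Ω₁ => B x := by
    have := (isClosed_closure (s := Ω₁)).measurableSet.standardBorel
    exact (hB.contDiff.continuous.measurable.comp measurable_subtype_coe).measurableEmbedding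
      fun x y hxy => Subtype.ext (hB.injOn x.2 y.2 hxy)
  set ω' : Space m → ℝ :=
    Function.extend (fun x : closure Ω₁ => B x) (fun x : closure Ω₁ => ω x) 0 with hω'
  have hω'm : Measurable ω' :=
    hemb.measurable_extend (hωc.measurable.comp measurable_subtype_coe) measurable_zero
  have hω'B : ∀ x ∈ closure Ω₁, ω' (B x) = ω x := fun x hx =>
    hemb.injective.extend_apply (fun x : closure Ω₁ => ω x) 0 ⟨x, hx⟩
  have hw'ω : ∀ x ∈ S', w' x = ω' x := by
    intro x hx
    rw [hS'A] at hx
    obtain ⟨z, hz, rfl⟩ := hx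
    have hz' := hScl z hz
    rw [show w' (A z) = w z from transported_apply hv.injOn w (hcl₁ hz'),
      show A z = B z from hAB hz', hω'B z hz',
      hωw z hz']
  have hbound : ∀ {k : Space m → ℝ}, Continuous k → ∃ C, ∀ x ∈ S, |k x| ≤ C := fun hk =>
    hSK.exists_bound_of_continuousOn hk.continuousOn
  -- rewrite the three surface integrals in terms of `normalHeight`
  have hF₁c : Continuous fun x : Space m => g * x (Fin.last m) * δρ * ω x := by fun_prop
  obtain ⟨C₁, hC₁⟩ := hbound hF₁c
  obtain ⟨hI₁, he₁⟩ := integrableOn_and_setIntegral_mul_outwardNormal hΩ.domain₁ hSf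
    hSc.measurableSet (G := fun x => g * x (Fin.last m) * δρ * w x) hF₁c.measurable hC₁
    fun x hx => by simp only [hωw x (hScl x hx)]
  have hF₂c : Continuous fun x : Space m => δρ * g * ω x ^ 2 := by fun_prop
  obtain ⟨C₂, hC₂⟩ := hbound hF₂c
  obtain ⟨hI₂, he₂⟩ := integrableOn_and_setIntegral_mul_outwardNormal hΩ.domain₁ hSf
    hSc.measurableSet (G := fun x => δρ * g * w x ^ 2) hF₂c.measurable hC₂
    fun x hx => by simp only [hωw x (hScl x hx)]
  have hF₃m : Measurable fun x : Space m => g * x (Fin.last m) * δρ * ω' x :=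
    ((measurable_const.mul hzc.measurable).mul measurable_const).mul hω'm
  have hF₃B : ∀ x ∈ S, g * B x (Fin.last m) * δρ * ω' (B x)
      = g * (x (Fin.last m) + δt * ω x) * δρ * ω x := fun x hx => by
    rw [hBl, hω'B x (hScl x hx)]
  obtain ⟨C₃, hC₃⟩ := hbound (k := fun x => g * (x (Fin.last m) + δt * ω x) * δρ * ω x)
    (by fun_prop)
  have hC₃' : ∀ x ∈ S, |g * B x (Fin.last m) * δρ * ω' (B x)| ≤ C₃ := fun x hx => by
    rw [hF₃B x hx]
    exact hC₃ x hx
  obtain ⟨hI₃, he₃⟩ := integrableOn_and_setIntegral_mul_outwardNormal hdom' hS'f hS'm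
    (G := fun x => g * x (Fin.last m) * δρ * w' x) hF₃m (C := C₃)
    (fun x hx => by
      rw [hS'B] at hx
      obtain ⟨z, hz, rfl⟩ := hx
      exact hC₃' z hz)
    fun x hx => by simp only [hw'ω x hx]
  have hvert : ∀ x ∈ Ω₁, W x = EuclideanSpace.single (Fin.last m) (W x (Fin.last m)) :=
    fun x hx => by
      conv_lhs => rw [hWw x (subset_closure hx), ← hωw x (subset_closure hx)]
  -- pull the new interface back to the old one along the vertical lines
  have hpull : ∫ x in S', g * x (Fin.last m) * δρ * ω' x * normalHeight (A '' Ω₁) x ∂μHE[m]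
      = ∫ x in S, g * (x (Fin.last m) + δt * ω x) * δρ * ω x * normalHeight Ω₁ x ∂μHE[m] := by
    rw [hS'B, hA₁, hB.setIntegral_image_mul_normalHeight hΩ.domain₁ ?_ ?_ hSf hSc hF₃m hC₃']
    · refine setIntegral_congr_fun hSc.measurableSet fun x hx => ?_
      simp only [hF₃B x hx]
    · intro x hx
      ext i
      have : W x i.castSucc = 0 := by
        rw [hWw x hx]
        simp [(Fin.castSucc_lt_last i).ne]
      simp [hBdef, meshMap, this]
    · intro x hx
      refine ⟨_, hB.det_pos x hx, ?_⟩
      rw [fderiv_meshMap_vertical hΩ.domain₁.isOpen hW hvert δt hx,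
        det_fderiv_meshMap_vertical hΩ.domain₁.isOpen hW hvert δt hx]
      ext i
      induction i using Fin.lastCases with
      | last => simp
      | cast i => simp [(Fin.castSucc_lt_last i).ne]
  -- express everything through two integrals over the old interface
  set X : ℝ := ∫ x in S, x (Fin.last m) * ω x * normalHeight Ω₁ x ∂μHE[m] with hX
  set Y : ℝ := ∫ x in S, ω x ^ 2 * normalHeight Ω₁ x ∂μHE[m] with hY
  have hint : ∀ {k : Space m → ℝ}, Continuous k →
      IntegrableOn (fun x => k x * normalHeight Ω₁ x) S μHE[m] := fun hk => by
    obtain ⟨C, hC⟩ := hbound hk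
    exact integrableOn_mul_normalHeight hΩ.domain₁.measure_frontier_lt_top hSf
      hSc.measurableSet hk.measurable hC
  have hXi : IntegrableOn (fun x => x (Fin.last m) * ω x * normalHeight Ω₁ x) S μHE[m] :=
    hint (hzc.mul hωc)
  have hYi : IntegrableOn (fun x => ω x ^ 2 * normalHeight Ω₁ x) S μHE[m] := hint (hωc.pow 2)
  have hcomb : ∀ (a b : ℝ) {k : Space m → ℝ},
      (∀ x ∈ S, k x = a * (x (Fin.last m) * ω x) + b * ω x ^ 2) →
      ∫ x in S, k x * normalHeight Ω₁ x ∂μHE[m] = a * X + b * Y := by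
    intro a b k hk
    rw [hX, hY, ← integral_const_mul, ← integral_const_mul,
      ← integral_add (hXi.const_mul a) (hYi.const_mul b)]
    refine setIntegral_congr_fun hSc.measurableSet fun x hx => ?_
    simp only [hk x hx]
    ring
  have hE₁ : ∫ x in S, g * x (Fin.last m) * δρ * w x * n x (Fin.last m) ∂σ = g * δρ * X := by
    refine he₁.trans ((hcomb (g * δρ) 0 fun x _ => ?_).trans (by ring))
    ring
  have hE₂ : ∫ x in S, δρ * g * w x ^ 2 * n x (Fin.last m) ∂σ = g * δρ * Y := by
    refine he₂.trans ((hcomb 0 (g * δρ) fun x _ => ?_).trans (by ring))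
    ring
  have hE₃ : ∫ x in S', g * x (Fin.last m) * δρ * w' x * n' x (Fin.last m) ∂σ
      = g * δρ * X + g * δρ * δt * Y := by
    refine he₃.trans (hpull.trans (hcomb (g * δρ) (g * δρ * δt) fun x _ => ?_))
    ring
  have hP : P' - P = -(δρ * g * (δt * X + δt ^ 2 / 2 * Y)) := by
    have h1 : P' = P - δρ * g * _ := hΩ.potentialEnergy_image hv hw g ρ₁ ρ₂
    rw [h1, hcomb δt (δt ^ 2 / 2) fun x hx => by rw [hωw x (hScl x hx)]]
    ring
  have hinner : ∀ (a s : ℝ) (ν : Space m),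
      a * inner ℝ (EuclideanSpace.single (Fin.last m) s) ν = a * s * ν (Fin.last m) :=
    fun a s ν => by rw [real_inner_comm, inner_single_last, mul_assoc]
  refine ⟨⟨?_, ?_, hI₁, hI₃, hI₂⟩, ⟨?_, ?_⟩, ?_, ?_⟩
  · exact integrableOn_density_mul ρ₁ ρ₂ g hΩ.domain.isBounded hΩ.domain₁.isOpen.measurableSet
      hΩ.domain₂.isOpen.measurableSet
  · obtain ⟨W₂, -, hB₂, hAB₂, -⟩ :=
      hv.smooth₂.exists_vertical_extension hΩ.subset₂ hv.injOn hw
    have hA₂ : A '' Ω₂ = meshMap δt W₂ '' Ω₂ := (hAB₂.mono subset_closure).image_eq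
    exact integrableOn_density_mul ρ₁ ρ₂ g (hΩ.isBounded_image hv hw) hdom'.isOpen.measurableSet
      (hA₂ ▸ hB₂.isOpen_image hΩ.domain₂.isOpen).measurableSet
  · refine setIntegral_congr_fun hSc.measurableSet fun x hx => ?_
    simp only [hw x (hcl₁ (hScl x hx)), hinner]
  · rw [hE₁, hE₂, hP]
    field_simp
    ring
  · refine setIntegral_congr_fun hS'm fun x hx => ?_
    rw [hS'A] at hx
    obtain ⟨z, hz, rfl⟩ := hx
    have hz' := hcl₁ (hScl z hz)
    have h1 : v' (A z) = EuclideanSpace.single (Fin.last m) (w' (A z)) := by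
      rw [show v' (A z) = v z from transported_apply hv.injOn v hz',
        show w' (A z) = w z from transported_apply hv.injOn w hz', hw z hz']
    simp only [h1, hinner]
  · rw [hE₃, hE₂, hP]
    field_simp
    ring
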